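/- Let $\mathbb X\subseteq\mathbb R$ be a time scale, i.e. a nonempty closed set, unbounded above, with jump operators $\sigma(t)=\inf\{s\in\mathbb X:s>t\}$, $\rho(t)=\sup\{s\in\mathbb X:s<t\}$ (with $\rho(t)=t$ if $t=\min\mathbb X$) and graininess $\mu(t)=\sigma(t)-t$. Let $t_0\in\mathbb X$, write $[t_0,\infty)_{\mathbb X}=[t_0,\infty)\cap\mathbb X$, and assume the Sturmian condition $\sigma(\rho(t))=\rho(\sigma(t))=t$ for all $t\in[t_0,\infty)_{\mathbb X}$. Let $A_1,A_2,B_1,B_2,B_3,B_4:[t_0,\infty)_{\mathbb X}\to\mathbb C^{n\times n}$ be rd-continuous, put $$A=\begin{pmatrix}A_1&0\\0&A_2\end{pmatrix},\quad B=\begin{pmatrix}B_1&B_2\\B_3&B_4\end{pmatrix},\quad J=\begin{pmatrix}0&-I_n\\I_n&0\end{pmatrix},\quad N(t)=\begin{pmatrix}0&0\\-\mu(t)(I_n+\mu(t)B_2(t))^{-1}&0\end{pmatrix},$$ and assume that, for every $t\in[t_0,\infty)_{\mathbb X}$, $A(t)$ is Hermitian positive semidefinite and $I_n+\mu(t)B_2(t)$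 and $I_n+\mu(t)B_3(t)$ are invertible. For $y=(y_1,y_2)$ with $y_1:[t_0,\infty)_{\mathbb X}\to\mathbb C^n$ and $y_2:[\rho(t_0),\infty)_{\mathbb X}\to\mathbb C^n$, put $\widehat y(t)=(y_1(t),y_2(\rho(t)))$. For $\lambda\in\mathbb C$ consider the system and its formal adjoint on $[t_0,\infty)_{\mathbb X}$, $$\text{(1)}\quad J\widehat y^{\,\Delta}(t)=(\lambda A(t)+B(t))\,y(t),\qquad\qquad \text{(2)}\quad J\widehat z^{\,\Delta}(t)=(\overline\lambda A(t)+B^*(t))\,z(t),$$ where ${}^\Delta$ is the delta derivative of functions on $[t_0,\infty)_{\mathbb X}$. A solution is a function $y$ for which $\widehat y$ is delta differentiable on $[t_0,\infty)_{\mathbb X}$ and the equation holds there. A function $y$ is $A$-square integrable if it is measurable and the delta integral $\int_{t_0}^\infty y^*(t)A(t)y(t)\,\Delta t$ exists and is finite. Theorem. Suppose that for some $\lambda'\in\mathbb C$ all solutions of (1) with $\lambda=\lambda'$ and all solutions of (2) with $\lambda=\lambda'$ are $A$-square integrable, and that $$A^{1/2}(t)N^*(t)A(t)N(t)A^{1/2}(t)\to0\quad\text{as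 } t\to\infty,\ t\in\mathbb X.$$ Then for every $\lambda\in\mathbb C$ all solutions of (1) are $A$-square integrable. -/

import Mathlib

open scoped ComplexOrder MatrixOrder

noncomputable section

namespace SturmianHamiltonian

/-! ### Time scales -/

/-- Forward jump `σ(t) = inf {s ∈ X : s > t}` of a time scale `X`, with the usual convention
`σ(t) = t` if `t` is the maximum of `X`. -/
def sigma (X : Set ℝ) (t : ℝ) : ℝ :=
  open Classical in if (X ∩ Set.Ioi t).Nonempty then sInf (X ∩ Set.Ioi t) else t

/-- Backward jump `ρ(t) = sup {s ∈ X : s < t}` of a time scale `X`, with the usual convention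
`ρ(t) = t` if `t` is the minimum of `X`. -/
def rho (X : Set ℝ) (t : ℝ) : ℝ :=
  open Classical in if (X ∩ Set.Iio t).Nonempty then sSup (X ∩ Set.Iio t) else t

/-- Graininess `μ(t) = σ(t) - t`. -/
def mu (X : Set ℝ) (t : ℝ) : ℝ := sigma X t - t

/-- The half-line `[t₀, ∞)_X = [t₀, ∞) ∩ X`. -/
def halfLine (X : Set ℝ) (t₀ : ℝ) : Set ℝ := X ∩ Set.Ici t₀

/-- The Sturmian condition `σ(ρ(t)) = ρ(σ(t)) = t` on `[t₀, ∞)_X`. -/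
def IsSturmian (X : Set ℝ) (t₀ : ℝ) : Prop :=
  ∀ t ∈ halfLine X t₀, sigma X (rho X t) = t ∧ rho X (sigma X t) = t

/-- `f`, considered as a function on `[t₀, ∞)_X`, is rd-continuous: continuous at right-dense
points, with finite left-hand limits at left-dense points. -/
def IsRdContinuous {E : Type*} [TopologicalSpace E] (X : Set ℝ) (t₀ : ℝ) (f : ℝ → E) : Prop :=
  ∀ t ∈ halfLine X t₀,
    (sigma X t = t → ContinuousWithinAt f (halfLine X t₀) t) ∧
    (rho X t = t → ∃ l, Filter.Tendsto f (nhdsWithin t (halfLine X t₀ ∩ Set.Iio t)) (nhds l))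

/-- `d` is the delta derivative at `t` of `f`, considered as a function on `[t₀, ∞)_X`. -/
def HasDeltaDerivAt {E : Type*} [NormedAddCommGroup E] [NormedSpace ℝ E]
    (X : Set ℝ) (t₀ : ℝ) (f : ℝ → E) (d : E) (t : ℝ) : Prop :=
  ∀ ε > 0, ∃ δ > 0, ∀ s ∈ halfLine X t₀, |s - t| < δ →
    ‖f (sigma X t) - f s - (sigma X t - s) • d‖ ≤ ε * |sigma X t - s|

/-- The Lebesgue delta measure of `[t₀, ∞)_X`: Lebesgue measure on `[t₀, ∞)_X` together with
a point mass `μ(t)` at each right-scattered point `t` (so that `[a, b)_X` has measure `b - a`). -/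
def deltaMeasure (X : Set ℝ) (t₀ : ℝ) : MeasureTheory.Measure ℝ :=
  MeasureTheory.volume.restrict (halfLine X t₀) +
    MeasureTheory.Measure.sum
      (fun t : {t : ℝ // t ∈ halfLine X t₀ ∧ t < sigma X t} =>
        ENNReal.ofReal (mu X t) • MeasureTheory.Measure.dirac (t : ℝ))

/-! ### The Hamiltonian system -/

/-- Complex `2n × 2n` matrices in `n × n` block form. -/
abbrev BlockMatrix (n : ℕ) := Matrix (Fin n ⊕ Fin n) (Fin n ⊕ Fin n) ℂ

/-- Vectors `y = (y₁, y₂)` in `ℂ^{2n}`, with `y₁` and `y₂` in `ℂ^n`. -/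
abbrev BlockVector (n : ℕ) := Fin n ⊕ Fin n → ℂ

/-- `J = (0 -I; I 0)`. -/
def matJ (n : ℕ) : BlockMatrix n := Matrix.fromBlocks 0 (-1) 1 0

/-- The partial left shift `ŷ(t) = (y₁(t), y₂(ρ(t)))`. -/
def hat {n : ℕ} (X : Set ℝ) (y : ℝ → BlockVector n) (t : ℝ) : BlockVector n :=
  Sum.elim (fun i => y t (Sum.inl i)) (fun i => y (rho X t) (Sum.inr i))

/-- `y` solves `J ŷ^Δ = (l A + B) y` on `[t₀, ∞)_X`; in particular `ŷ`, i.e. `y₁` and `y₂ ∘ ρ`,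
is delta differentiable there. -/
def IsSolution {n : ℕ} (X : Set ℝ) (t₀ : ℝ) (A B : ℝ → BlockMatrix n) (l : ℂ)
    (y : ℝ → BlockVector n) : Prop :=
  ∀ t ∈ halfLine X t₀, ∃ d : BlockVector n,
    HasDeltaDerivAt X t₀ (hat X y) d t ∧
    (matJ n).mulVec d = (l • A t + B t).mulVec (y t)

/-- `y` solves the formal adjoint system `J ẑ^Δ = (conj l A + B^*) z` on `[t₀, ∞)_X`. -/
def IsAdjointSolution {n : ℕ} (X : Set ℝ) (t₀ : ℝ) (A B : ℝ → BlockMatrix n) (l : ℂ)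
    (z : ℝ → BlockVector n) : Prop :=
  IsSolution X t₀ A (fun t => (B t).conjTranspose) (starRingEnd ℂ l) z

/-- `y` is `A`-square integrable: it is measurable and the delta integral over `[t₀, ∞)_X` of
`y^* A y` exists and is finite. -/
def IsSquareIntegrable {n : ℕ} (X : Set ℝ) (t₀ : ℝ) (A : ℝ → BlockMatrix n)
    (y : ℝ → BlockVector n) : Prop :=
  MeasureTheory.AEStronglyMeasurable y (deltaMeasure X t₀) ∧
  MeasureTheory.Integrable (fun t => dotProduct (star (y t)) ((A t).mulVec (y t)))
    (deltaMeasure X t₀)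

/-- `N(t) = (0 0; -μ(t) (I + μ(t) B₂(t))⁻¹ 0)`. -/
def matN {n : ℕ} (X : Set ℝ) (B₂ : ℝ → Matrix (Fin n) (Fin n) ℂ) (t : ℝ) : BlockMatrix n :=
  Matrix.fromBlocks 0 0 (-((mu X t : ℂ) • (1 + (mu X t : ℂ) • B₂ t)⁻¹)) 0

end SturmianHamiltonian

end

namespace SturmianHamiltonian

open Set Filter Topology MeasureTheory

variable {X : Set ℝ} {t₀ : ℝ}

/-! ### Jump operators -/

/-! The theorem is variation of constants around `l'`. Lagrange's identity makes the bracket `ẑ^* J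
ŷ` of a solution and an adjoint solution for `l'` constant, so there are fundamental systems `Y j`,
`Z j` with bracket matrix `J`. If `y` solves the system for `l`, then `ŷ` is a combination of the `Ŷ
j` whose coefficients are, up to the factor `-J`, the brackets `d j` of `Z j` with `y`, and `d j`
has delta derivative `(l - l') (Z j)^* A y`.

The expansion concerns `ŷ`. Returning to `y` produces the factor `1 + (l - l') N A`
(`eq_mulVec_sum`). The limit assumption gives `‖A^{1/2} N A^{1/2}‖ ≤ 1` for large `t`, whence
`‖A^{1/2} y‖ ≤ (1 + |l - l'|) α ‖d‖` with `α = ∑ ‖A^{1/2} Y j‖`. So `d` satisfies an integral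
inequality whose kernel is a multiple of `β α`, with `β = ∑ ‖A^{1/2} Z j‖`. This kernel is
integrable by both square integrability assumptions, `d` is bounded
(`exists_norm_le_of_integral_ineq`), and `y` is square integrable because `α` is.

Analysis on `X` is pulled back to the real line by `flr`: the delta measure is the image of Lebesgue
measure (`deltaMeasure_eq_map`). The Sturmian condition makes right-scattered points isolated, so
delta differentiability splits into an ordinary derivative at dense points and a jump formula
(`hasDeltaDerivAt_iff`). -/

theorem exists_mem_gt (hub : ¬ BddAbove X) (t : ℝ) : (X ∩ Ioi t).Nonempty := by
  obtain ⟨x, hx, h⟩ := not_bddAbove_iff.1 hub t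
  exact ⟨x, hx, h⟩

theorem sigma_eq (hub : ¬ BddAbove X) (t : ℝ) : sigma X t = sInf (X ∩ Ioi t) :=
  if_pos (exists_mem_gt hub t)

theorem le_sigma (hub : ¬ BddAbove X) (t : ℝ) : t ≤ sigma X t := by
  rw [sigma_eq hub]
  exact le_csInf (exists_mem_gt hub t) fun _ h => h.2.le

theorem sigma_le (hub : ¬ BddAbove X) {s t : ℝ} (hs : s ∈ X) (h : t < s) : sigma X t ≤ s := by
  rw [sigma_eq hub]
  exact csInf_le ⟨t, fun _ h => h.2.le⟩ ⟨hs, h⟩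

theorem sigma_mem (hc : IsClosed X) (hub : ¬ BddAbove X) (t : ℝ) : sigma X t ∈ X := by
  rw [sigma_eq hub]
  have h := csInf_mem_closure (exists_mem_gt hub t) ⟨t, fun _ h => h.2.le⟩
  exact hc.closure_subset (closure_mono inter_subset_left h)

theorem exists_lt_of_sigma_lt (hub : ¬ BddAbove X) {t r : ℝ} (h : sigma X t < r) :
    ∃ s ∈ X, t < s ∧ s < r := by
  rw [sigma_eq hub] at h
  obtain ⟨s, hs, hr⟩ := exists_lt_of_csInf_lt (exists_mem_gt hub t) h
  exact ⟨s, hs.1, hs.2, hr⟩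

theorem rho_le (t : ℝ) : rho X t ≤ t := by
  unfold rho
  split_ifs with h
  · exact csSup_le h fun _ h => h.2.le
  · exact le_rfl

theorem le_rho {s t : ℝ} (hs : s ∈ X) (h : s < t) : s ≤ rho X t := by
  have hne : (X ∩ Iio t).Nonempty := ⟨s, hs, h⟩
  rw [rho, if_pos hne]
  exact le_csSup ⟨t, fun _ h => h.2.le⟩ ⟨hs, h⟩

theorem rho_mem (hc : IsClosed X) {t : ℝ} (ht : t ∈ X) : rho X t ∈ X := by
  unfold rho
  split_ifs with h
  · exact hc.closure_subset
      (closure_mono inter_subset_left (csSup_mem_closure h ⟨t, fun _ h => h.2.le⟩))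
  · exact ht

theorem exists_gt_of_lt_rho {t r s : ℝ} (hs : s ∈ X) (hst : s < t) (h : r < rho X t) :
    ∃ x ∈ X, r < x ∧ x < t := by
  have hne : (X ∩ Iio t).Nonempty := ⟨s, hs, hst⟩
  rw [rho, if_pos hne] at h
  obtain ⟨x, hx, hr⟩ := exists_lt_of_lt_csSup hne h
  exact ⟨x, hx.1, hr, hx.2⟩

theorem sigma_mem_halfLine (hc : IsClosed X) (hub : ¬ BddAbove X) {t : ℝ}
    (ht : t ∈ halfLine X t₀) : sigma X t ∈ halfLine X t₀ :=
  ⟨sigma_mem hc hub t, le_trans ht.2 (le_sigma hub t)⟩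

theorem mu_nonneg (hub : ¬ BddAbove X) (t : ℝ) : 0 ≤ mu X t := sub_nonneg.2 (le_sigma hub t)

theorem IsSturmian.rho_eq (hS : IsSturmian X t₀) {t : ℝ} (ht : t ∈ halfLine X t₀)
    (h : sigma X t = t) : rho X t = t := by
  simpa [h] using (hS t ht).2

theorem IsSturmian.rho_lt (hS : IsSturmian X t₀) {t : ℝ} (ht : t ∈ halfLine X t₀)
    (h : sigma X t ≠ t) : rho X t < t :=
  lt_of_le_of_ne (rho_le t) fun h' => h (by simpa [h'] using (hS t ht).1)

/-- If `ρ(t) = t`, then `t = σ(ρ(t)) = σ(t)`. A right-scattered point is therefore left-scattered as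
well. -/
theorem IsSturmian.isolated (hub : ¬ BddAbove X) (hS : IsSturmian X t₀) {t : ℝ}
    (ht : t ∈ halfLine X t₀) (h : sigma X t ≠ t) :
    ∃ δ > 0, ∀ s ∈ halfLine X t₀, |s - t| < δ → s = t := by
  have h1 := hS.rho_lt ht h
  have h2 : t < sigma X t := lt_of_le_of_ne (le_sigma hub t) h.symm
  refine ⟨min (t - rho X t) (sigma X t - t), lt_min (by linarith) (by linarith),
    fun s hs hd => ?_⟩
  obtain ⟨h3, h4⟩ := abs_lt.1 hd
  have h5 := min_le_left (t - rho X t) (sigma X t - t)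
  have h6 := min_le_right (t - rho X t) (sigma X t - t)
  rcases lt_trichotomy s t with hst | hst | hst
  · have := le_rho hs.1 hst
    linarith
  · exact hst
  · have := sigma_le hub hs.1 hst
    linarith

theorem IsSturmian.nhdsWithin_eq_pure (hub : ¬ BddAbove X) (hS : IsSturmian X t₀) {t : ℝ}
    (ht : t ∈ halfLine X t₀) (h : sigma X t ≠ t) : 𝓝[halfLine X t₀] t = pure t := by
  obtain ⟨δ, hδ, hi⟩ := hS.isolated hub ht h
  refine le_antisymm ?_ (pure_le_nhdsWithin ht)
  rw [le_pure_iff, Metric.mem_nhdsWithin_iff]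
  exact ⟨δ, hδ, fun s hs => hi s hs.2 (by simpa [Real.dist_eq] using hs.1)⟩

/-- To be continuous on a Sturmian half-line it suffices to be so at the dense points. -/
theorem IsSturmian.continuousOn {E : Type*} [TopologicalSpace E] (hub : ¬ BddAbove X)
    (hS : IsSturmian X t₀) {f : ℝ → E}
    (hf : ∀ t ∈ halfLine X t₀, sigma X t = t → ContinuousWithinAt f (halfLine X t₀) t) :
    ContinuousOn f (halfLine X t₀) := by
  intro t ht
  by_cases h : sigma X t = t
  · exact hf t ht h
  · rw [ContinuousWithinAt, hS.nhdsWithin_eq_pure hub ht h]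
    exact tendsto_pure_nhds f t

theorem IsRdContinuous.continuousOn {E : Type*} [TopologicalSpace E] (hub : ¬ BddAbove X)
    (hS : IsSturmian X t₀) {f : ℝ → E} (hf : IsRdContinuous X t₀ f) :
    ContinuousOn f (halfLine X t₀) :=
  hS.continuousOn hub fun t ht => (hf t ht).1

/-- A dense point other than `t₀` is a limit from the left. -/
theorem IsSturmian.exists_left (hS : IsSturmian X t₀) (ht₀ : t₀ ∈ X) {t r : ℝ}
    (ht : t ∈ halfLine X t₀) (h : sigma X t = t) (h0 : t₀ < t) (hr : r < t) :
    ∃ s ∈ halfLine X t₀, r < s ∧ s < t := by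
  have h1 : max r t₀ < rho X t := by rw [hS.rho_eq ht h]; exact max_lt hr h0
  obtain ⟨x, hx, h2, h3⟩ := exists_gt_of_lt_rho ht₀ h0 h1
  exact ⟨x, ⟨hx, (le_max_right _ _).trans h2.le⟩, (le_max_left _ _).trans_lt h2, h3⟩

theorem continuousOn_sigma (hub : ¬ BddAbove X) (hS : IsSturmian X t₀) :
    ContinuousOn (sigma X) (halfLine X t₀) := by
  refine hS.continuousOn hub fun t ht h => ?_
  rw [ContinuousWithinAt, h, Metric.tendsto_nhdsWithin_nhds]
  intro ε hε
  obtain ⟨x, hx, h1, h2⟩ := exists_lt_of_sigma_lt hub (t := t) (r := t + ε) (by linarith)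
  refine ⟨min ε (x - t), lt_min hε (by linarith), fun s hs hd => ?_⟩
  rw [Real.dist_eq, abs_lt] at hd ⊢
  have h5 := min_le_left ε (x - t)
  have h6 := min_le_right ε (x - t)
  have h3 := sigma_le hub hx (t := s) (by linarith)
  have h4 := le_sigma hub s
  constructor <;> linarith

theorem continuousOn_mu (hub : ¬ BddAbove X) (hS : IsSturmian X t₀) :
    ContinuousOn (mu X) (halfLine X t₀) :=
  (continuousOn_sigma hub hS).sub continuousOn_id

theorem isClosed_halfLine (hc : IsClosed X) : IsClosed (halfLine X t₀) := hc.inter isClosed_Ici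

/-! ### Projection of the real half-line onto the time scale -/

/-- The largest point of `[t₀, ∞)_X` that does not exceed `max t₀ s`. -/
noncomputable def flr (X : Set ℝ) (t₀ s : ℝ) : ℝ := sSup (halfLine X t₀ ∩ Iic (max t₀ s))

theorem flr_set_nonempty (ht₀ : t₀ ∈ X) (s : ℝ) :
    (halfLine X t₀ ∩ Iic (max t₀ s)).Nonempty :=
  ⟨t₀, ⟨ht₀, self_mem_Ici⟩, mem_Iic.2 (le_max_left _ _)⟩

theorem flr_set_bddAbove (s : ℝ) : BddAbove (halfLine X t₀ ∩ Iic (max t₀ s)) :=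
  ⟨_, fun _ h => h.2⟩

theorem flr_mem_inter (hc : IsClosed X) (ht₀ : t₀ ∈ X) (s : ℝ) :
    flr X t₀ s ∈ halfLine X t₀ ∩ Iic (max t₀ s) :=
  ((isClosed_halfLine hc).inter isClosed_Iic).csSup_mem (flr_set_nonempty ht₀ s)
    (flr_set_bddAbove s)

theorem flr_mem (hc : IsClosed X) (ht₀ : t₀ ∈ X) (s : ℝ) : flr X t₀ s ∈ halfLine X t₀ :=
  (flr_mem_inter hc ht₀ s).1

theorem flr_le (hc : IsClosed X) (ht₀ : t₀ ∈ X) {s : ℝ} (hs : t₀ ≤ s) : flr X t₀ s ≤ s := by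
  simpa [hs] using (flr_mem_inter hc ht₀ s).2

theorem le_flr {s t : ℝ} (ht : t ∈ halfLine X t₀) (h : t ≤ s) : t ≤ flr X t₀ s :=
  le_csSup (flr_set_bddAbove s) ⟨ht, h.trans (le_max_right _ _)⟩

theorem flr_eq_self (hc : IsClosed X) (ht₀ : t₀ ∈ X) {t : ℝ} (ht : t ∈ halfLine X t₀) :
    flr X t₀ t = t :=
  le_antisymm (flr_le hc ht₀ ht.2) (le_flr ht le_rfl)

theorem flr_eq (hc : IsClosed X) (hub : ¬ BddAbove X) (ht₀ : t₀ ∈ X) {s t : ℝ}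
    (ht : t ∈ halfLine X t₀) (h1 : t ≤ s) (h2 : s < sigma X t) : flr X t₀ s = t := by
  refine le_antisymm (not_lt.1 fun h => ?_) (le_flr ht h1)
  have h3 := sigma_le hub (flr_mem hc ht₀ s).1 h
  have h4 := flr_le hc ht₀ (ht.2.trans h1)
  linarith

theorem monotone_flr (ht₀ : t₀ ∈ X) : Monotone (flr X t₀) := fun _ b hab =>
  csSup_le_csSup (flr_set_bddAbove b) (flr_set_nonempty ht₀ _)
    (inter_subset_inter_right _ (Iic_subset_Iic.2 (max_le_max le_rfl hab)))

/-- Otherwise maximality of `flr s` makes it right-dense and smaller than `s`, and a larger point of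
`X` lies below `s`. -/
theorem lt_sigma_flr (hc : IsClosed X) (hub : ¬ BddAbove X) (ht₀ : t₀ ∈ X) {s : ℝ}
    (hs : t₀ ≤ s) (h : s ∉ X) : s < sigma X (flr X t₀ s) := by
  by_contra! h'
  have h1 : sigma X (flr X t₀ s) ∈ halfLine X t₀ :=
    sigma_mem_halfLine hc hub (flr_mem hc ht₀ s)
  have h2 := le_flr h1 h'
  have h3 := le_sigma hub (flr X t₀ s)
  have h4 : flr X t₀ s < s :=
    lt_of_le_of_ne (flr_le hc ht₀ hs) fun e => h (e ▸ (flr_mem hc ht₀ s).1)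
  obtain ⟨x, hx, h5, h6⟩ := exists_lt_of_sigma_lt hub (h2.trans_lt h4)
  have := le_flr (X := X) ⟨hx, ((flr_mem hc ht₀ s).2.trans h5.le : t₀ ≤ x)⟩ h6.le
  linarith

/-- A dense `t > t₀` has points `x < t` of the half-line arbitrarily close, and `x ≤ flr s ≤ s` for
`s ≥ x`; for `t = t₀` take `x = t₀`. -/
theorem tendsto_flr (hc : IsClosed X) (hS : IsSturmian X t₀)
    (ht₀ : t₀ ∈ X) {t : ℝ} (ht : t ∈ halfLine X t₀) (h : sigma X t = t) :
    Tendsto (flr X t₀) (𝓝[Ici t₀] t) (𝓝 t) := by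
  rw [Metric.tendsto_nhdsWithin_nhds]
  intro ε hε
  have h1 : ∃ x ∈ halfLine X t₀, t - ε < x ∧ x ≤ t ∧ (x = t → t = t₀) := by
    rcases eq_or_lt_of_le (mem_Ici.1 ht.2) with h0 | h0
    · exact ⟨t, ht, by linarith, le_rfl, fun _ => h0.symm⟩
    · obtain ⟨x, hx, h2, h3⟩ := hS.exists_left ht₀ ht h h0 (r := t - ε) (by linarith)
      exact ⟨x, hx, h2, h3.le, fun e => absurd e h3.ne⟩
  obtain ⟨x, hx, h2, h3, h4⟩ := h1
  have h5 : ∃ δ > 0, ∀ s ∈ Ici t₀, |s - t| < δ → x ≤ s := by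
    rcases eq_or_lt_of_le h3 with h6 | h6
    · exact ⟨1, one_pos, fun s hs _ => by rw [h6, h4 h6]; exact hs⟩
    · exact ⟨t - x, by linarith, fun s _ hd => by have := (abs_lt.1 hd).1; linarith⟩
  obtain ⟨δ, hδ, h5⟩ := h5
  refine ⟨min δ ε, lt_min hδ hε, fun s hs hd => ?_⟩
  rw [Real.dist_eq] at hd ⊢
  have h7 := le_flr hx (h5 s hs (hd.trans_le (min_le_left _ _)))
  have h8 := (abs_lt.1 (hd.trans_le (min_le_right _ _))).2
  have h9 := flr_le hc ht₀ hs
  rw [abs_lt]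
  constructor <;> linarith

theorem measurable_flr (ht₀ : t₀ ∈ X) : Measurable (flr X t₀) := (monotone_flr ht₀).measurable

theorem stronglyMeasurable_comp_flr {E : Type*} [TopologicalSpace E]
    [TopologicalSpace.PseudoMetrizableSpace E] (hc : IsClosed X) (ht₀ : t₀ ∈ X) {f : ℝ → E}
    (hf : ContinuousOn f (halfLine X t₀)) : StronglyMeasurable fun s => f (flr X t₀ s) :=
  ((continuousOn_iff_continuous_domRestrict.1 hf).stronglyMeasurable.comp_measurable
    ((measurable_flr ht₀).subtype_mk (h := flr_mem hc ht₀)) :)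

theorem exists_norm_le {E : Type*} [NormedAddCommGroup E] (hc : IsClosed X) {f : ℝ → E}
    (hf : ContinuousOn f (halfLine X t₀)) (T : ℝ) :
    ∃ C, 0 ≤ C ∧ ∀ t ∈ halfLine X t₀, t ≤ T → ‖f t‖ ≤ C := by
  have hK : IsCompact (halfLine X t₀ ∩ Icc t₀ T) := isCompact_Icc.inter_left (isClosed_halfLine hc)
  obtain ⟨C, hC⟩ := hK.exists_bound_of_continuousOn (hf.mono inter_subset_left)
  exact ⟨max C 0, le_max_right _ _,
    fun t ht h => (hC t ⟨ht, ht.2, h⟩).trans (le_max_left _ _)⟩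

theorem integrableOn_comp_flr {E : Type*} [NormedAddCommGroup E] (hc : IsClosed X)
    (ht₀ : t₀ ∈ X) {f : ℝ → E} (hf : ContinuousOn f (halfLine X t₀)) (T : ℝ) :
    IntegrableOn (fun s => f (flr X t₀ s)) (Icc t₀ T) := by
  obtain ⟨C, -, hC⟩ := exists_norm_le hc hf T
  refine IntegrableOn.of_bound measure_Icc_lt_top
    (stronglyMeasurable_comp_flr hc ht₀ hf).aestronglyMeasurable C ?_
  exact (ae_restrict_iff' measurableSet_Icc).2 <| .of_forall fun s hs =>
    hC _ (flr_mem hc ht₀ s) ((flr_le hc ht₀ hs.1).trans hs.2)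

theorem intervalIntegrable_comp_flr {E : Type*} [NormedAddCommGroup E] (hc : IsClosed X)
    (ht₀ : t₀ ∈ X) {f : ℝ → E} (hf : ContinuousOn f (halfLine X t₀)) {a b : ℝ} (ha : t₀ ≤ a)
    (hb : t₀ ≤ b) : IntervalIntegrable (fun s => f (flr X t₀ s)) volume a b := by
  refine ((integrableOn_comp_flr hc ht₀ hf (max a b)).mono_set ?_).intervalIntegrable
  exact Icc_subset_Icc (le_min ha hb) le_rfl

/-! ### The delta measure -/

theorem Ici_eq_union (hc : IsClosed X) (hub : ¬ BddAbove X) (ht₀ : t₀ ∈ X) :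
    Ici t₀ = halfLine X t₀ ∪ ⋃ t : {t : ℝ // t ∈ halfLine X t₀ ∧ t < sigma X t},
      Ioo (t : ℝ) (sigma X t) := by
  ext s
  simp only [mem_union, mem_iUnion, mem_Ioo]
  constructor
  · intro hs
    by_cases h : s ∈ X
    · exact Or.inl ⟨h, hs⟩
    · have h1 := lt_sigma_flr hc hub ht₀ hs h
      have h4 : flr X t₀ s < s :=
        lt_of_le_of_ne (flr_le hc ht₀ hs) fun e => h (e ▸ (flr_mem hc ht₀ s).1)
      exact Or.inr ⟨⟨_, flr_mem hc ht₀ s, h4.trans h1⟩, h4, h1⟩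
  · rintro (h | ⟨t, h, -⟩)
    · exact h.2
    · exact le_trans t.2.1.2 h.le

theorem disjoint_gap (hub : ¬ BddAbove X) {s t : ℝ} (hs : s ∈ X) (ht : t ∈ X) (h : s ≠ t) :
    Disjoint (Ioo s (sigma X s)) (Ioo t (sigma X t)) := by
  rw [Set.disjoint_left]
  rintro x ⟨h1, h2⟩ ⟨h3, h4⟩
  rcases lt_or_gt_of_ne h with h | h
  · have := sigma_le hub ht h; linarith
  · have := sigma_le hub hs h; linarith

theorem countable_gaps (hub : ¬ BddAbove X) :
    Countable {t : ℝ // t ∈ halfLine X t₀ ∧ t < sigma X t} := by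
  have : Set.Countable {t : ℝ | t ∈ halfLine X t₀ ∧ t < sigma X t} :=
    Set.PairwiseDisjoint.countable_of_Ioo (y := sigma X)
      (fun s hs t ht h => disjoint_gap hub hs.1.1 ht.1.1 h) fun s hs => hs.2
  exact this.to_subtype

/-- The ray splits into the half-line, which `flr` fixes, and countably many gaps `(t, σ(t))` of
length `μ(t)`, each of which `flr` collapses to `t`. -/
theorem deltaMeasure_eq_map (hc : IsClosed X) (hub : ¬ BddAbove X) (ht₀ : t₀ ∈ X) :
    deltaMeasure X t₀ = (volume.restrict (Ici t₀)).map (flr X t₀) := by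
  have := countable_gaps (t₀ := t₀) hub
  ext S hS
  have hm := measurable_flr (X := X) ht₀
  rw [Measure.map_apply hm hS, Measure.restrict_apply (hm hS), Ici_eq_union hc hub ht₀,
    inter_union_distrib_left, inter_iUnion, measure_union, measure_iUnion, deltaMeasure,
    Measure.add_apply, Measure.restrict_apply hS, Measure.sum_apply _ hS]
  · congr 1
    · congr 1
      ext s
      refine and_congr_left fun hs => ?_
      rw [mem_preimage, flr_eq_self hc ht₀ hs]
    · refine tsum_congr fun t => ?_
      rw [Measure.smul_apply, Measure.dirac_apply' _ hS]
      have h : ∀ s ∈ Ioo (t : ℝ) (sigma X t), flr X t₀ s = t := fun s hs =>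
        flr_eq hc hub ht₀ t.2.1 hs.1.le hs.2
      by_cases ht : (t : ℝ) ∈ S
      · have : flr X t₀ ⁻¹' S ∩ Ioo (t : ℝ) (sigma X t) = Ioo (t : ℝ) (sigma X t) :=
          inter_eq_right.2 fun s hs => by rw [mem_preimage, h s hs]; exact ht
        simp [this, ht, mu]
      · have : flr X t₀ ⁻¹' S ∩ Ioo (t : ℝ) (sigma X t) = ∅ := by
          ext s
          simp only [mem_inter_iff, mem_preimage, mem_empty_iff_false, iff_false, not_and]
          intro h1 h2
          exact ht (h s h2 ▸ h1)
        simp [this, ht]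
  · intro s t hst
    exact (disjoint_gap hub s.2.1.1 t.2.1.1 (Subtype.coe_injective.ne hst)).mono
      inter_subset_right inter_subset_right
  · exact fun t => (hm hS).inter measurableSet_Ioo
  · rw [Set.disjoint_left]
    rintro s ⟨-, hs⟩ h
    obtain ⟨t, -, h1, h2⟩ := mem_iUnion.1 h
    have := sigma_le hub hs.1 h1
    linarith
  · exact .iUnion fun t => (hm hS).inter measurableSet_Ioo

theorem aestronglyMeasurable_deltaMeasure {E : Type*} [TopologicalSpace E]
    [TopologicalSpace.PseudoMetrizableSpace E]
    (hc : IsClosed X) (hub : ¬ BddAbove X) (ht₀ : t₀ ∈ X) {f : ℝ → E}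
    (hf : ContinuousOn f (halfLine X t₀)) : AEStronglyMeasurable f (deltaMeasure X t₀) := by
  have hH := (isClosed_halfLine (t₀ := t₀) hc).measurableSet
  have h : (deltaMeasure X t₀).restrict (halfLine X t₀) = deltaMeasure X t₀ := by
    refine Measure.restrict_eq_self_of_ae_mem ?_
    rw [deltaMeasure_eq_map hc hub ht₀]
    exact (ae_map_iff (measurable_flr ht₀).aemeasurable hH).2 (.of_forall (flr_mem hc ht₀))
  rw [← h]
  exact hf.aestronglyMeasurable hH

theorem integrable_deltaMeasure_iff {E : Type*} [NormedAddCommGroup E]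
    (hc : IsClosed X) (hub : ¬ BddAbove X) (ht₀ : t₀ ∈ X) {f : ℝ → E}
    (hf : ContinuousOn f (halfLine X t₀)) :
    Integrable f (deltaMeasure X t₀) ↔ IntegrableOn (fun s => f (flr X t₀ s)) (Ici t₀) := by
  have h := aestronglyMeasurable_deltaMeasure hc hub ht₀ hf
  rw [deltaMeasure_eq_map hc hub ht₀] at h ⊢
  exact integrable_map_measure h (measurable_flr ht₀).aemeasurable

/-! ### Delta derivatives on a Sturmian half-line -/

section Calculus

variable {E : Type*} [NormedAddCommGroup E] [NormedSpace ℝ E]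

/-- Taking `s = t` in the definition gives the jump formula. At a right-scattered point isolation
leaves no other `s`; at a right-dense point the definition is that of the ordinary derivative. -/
theorem hasDeltaDerivAt_iff (hub : ¬ BddAbove X) (hS : IsSturmian X t₀) {f : ℝ → E} {d : E}
    {t : ℝ} (ht : t ∈ halfLine X t₀) :
    HasDeltaDerivAt X t₀ f d t ↔
      (sigma X t = t → HasDerivWithinAt f d (halfLine X t₀) t) ∧
        f (sigma X t) = f t + mu X t • d := by
  constructor
  · intro h
    refine ⟨fun hd => ?_, ?_⟩
    · rw [hasDerivWithinAt_iff_isLittleO, Asymptotics.isLittleO_iff]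
      intro ε hε
      obtain ⟨δ, hδ, h⟩ := h ε hε
      rw [Filter.eventually_iff, Metric.mem_nhdsWithin_iff]
      refine ⟨δ, hδ, fun s hs => ?_⟩
      have := h s hs.2 (by simpa [Real.dist_eq] using hs.1)
      rw [hd] at this
      rw [mem_ofPred_eq, Real.norm_eq_abs, abs_sub_comm s t]
      convert this using 1
      rw [← norm_neg]
      congr 1
      module
    · have h0 : ‖f (sigma X t) - f t - mu X t • d‖ ≤ 0 := by
        refine le_of_forall_pos_le_add fun ε hε => ?_
        have hm := mu_nonneg (X := X) hub t
        -- The `+ 1` covers `μ(t) = 0`.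
        obtain ⟨δ, hδ, h⟩ := h (ε / (mu X t + 1)) (by positivity)
        have := h t ht (by simpa using hδ)
        refine this.trans ?_
        change _ * |mu X t| ≤ _
        rw [abs_of_nonneg hm, zero_add, div_mul_eq_mul_div, div_le_iff₀ (by positivity)]
        nlinarith
      have := norm_le_zero_iff.1 h0
      rw [sub_sub, sub_eq_zero] at this
      exact this
  · rintro ⟨h1, h2⟩ ε hε
    by_cases hd : sigma X t = t
    · have h1 := h1 hd
      rw [hasDerivWithinAt_iff_isLittleO, Asymptotics.isLittleO_iff] at h1
      obtain ⟨δ, hδ, h1⟩ := Metric.mem_nhdsWithin_iff.1 (h1 hε)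
      refine ⟨δ, hδ, fun s hs hst => ?_⟩
      have : s ∈ Metric.ball t δ ∩ halfLine X t₀ := ⟨by simpa [Real.dist_eq] using hst, hs⟩
      have := h1 this
      rw [mem_ofPred_eq, Real.norm_eq_abs, abs_sub_comm s t] at this
      rw [hd]
      convert this using 1
      rw [← norm_neg]
      congr 1
      module
    · obtain ⟨δ, hδ, hi⟩ := hS.isolated hub ht hd
      refine ⟨δ, hδ, fun s hs hst => ?_⟩
      rw [hi s hs hst, h2]
      have : f t + mu X t • d - f t - (sigma X t - t) • d = 0 := by rw [mu]; abel
      rw [this, norm_zero]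
      positivity

theorem continuousOn_of_hasDeltaDerivAt (hub : ¬ BddAbove X) (hS : IsSturmian X t₀) {f : ℝ → E}
    (h : ∀ t ∈ halfLine X t₀, ∃ d, HasDeltaDerivAt X t₀ f d t) :
    ContinuousOn f (halfLine X t₀) := by
  refine hS.continuousOn hub fun t ht hd => ?_
  obtain ⟨d, h⟩ := h t ht
  exact (((hasDeltaDerivAt_iff hub hS ht).1 h).1 hd).continuousWithinAt

/-- A function with vanishing delta derivative is constant. -/
theorem eq_of_hasDeltaDerivAt_zero (hc : IsClosed X) (hub : ¬ BddAbove X) (hS : IsSturmian X t₀)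
    (ht₀ : t₀ ∈ X) {f : ℝ → E} (h : ∀ t ∈ halfLine X t₀, HasDeltaDerivAt X t₀ f 0 t)
    {t : ℝ} (ht : t ∈ halfLine X t₀) : f t = f t₀ := by
  have h0 : t₀ ∈ halfLine X t₀ := ⟨ht₀, self_mem_Ici⟩
  have hcont := continuousOn_of_hasDeltaDerivAt hub hS fun t ht => ⟨_, h t ht⟩
  have hsig : ∀ t ∈ halfLine X t₀, f (sigma X t) = f t := fun t ht => by
    simpa using ((hasDeltaDerivAt_iff hub hS ht).1 (h t ht)).2
  -- `f ∘ flr` is a continuous function on a real interval with vanishing right derivative.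
  have key := constant_of_has_deriv_right_zero (f := fun s => f (flr X t₀ s)) (a := t₀) (b := t)
    ?_ ?_ t (right_mem_Icc.2 ht.2)
  · simpa [flr_eq_self hc ht₀ ht, flr_eq_self hc ht₀ h0] using key
  · intro s hs
    refine ContinuousWithinAt.mono ?_ (Icc_subset_Ici_self : Icc t₀ t ⊆ Ici t₀)
    by_cases hsX : s ∈ X
    · have hsH : s ∈ halfLine X t₀ := ⟨hsX, hs.1⟩
      have hself := flr_eq_self hc ht₀ hsH
      by_cases hd : sigma X s = s
      · have h1 := tendsto_flr hc hS ht₀ hsH hd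
        have h2 : Tendsto (flr X t₀) (𝓝[Ici t₀] s) (𝓝[halfLine X t₀] s) :=
          tendsto_nhdsWithin_iff.2 ⟨h1, .of_forall (flr_mem hc ht₀)⟩
        rw [ContinuousWithinAt, hself]
        exact (hcont s hsH).tendsto.comp h2
      · have hr := hS.rho_lt hsH hd
        have hss : s < sigma X s := lt_of_le_of_ne (le_sigma hub s) (Ne.symm hd)
        -- Just to the left of `s`, `flr` takes the value `ρ(s)`, and `f(ρ(s)) = f(σ(ρ(s))) = f(s)`.
        refine (continuousWithinAt_const (b := f s)).congr_of_eventuallyEq ?_ (by rw [hself])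
        filter_upwards [self_mem_nhdsWithin,
          mem_nhdsWithin_of_mem_nhds (Ioo_mem_nhds hr hss)] with r hr0 hr1
        rcases lt_or_ge r s with hlt | hge
        · have h3 : t₀ < s := lt_of_le_of_lt hr0 hlt
          have h4 : rho X s ∈ halfLine X t₀ := ⟨rho_mem hc hsX, le_rho ht₀ h3⟩
          rw [flr_eq hc hub ht₀ h4 hr1.1.le (by rw [(hS s hsH).1]; exact hlt), ← hsig _ h4,
            (hS s hsH).1]
        · rw [flr_eq hc hub ht₀ hsH hge hr1.2]
    · have h1 := lt_sigma_flr hc hub ht₀ hs.1 hsX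
      have h2 : flr X t₀ s < s :=
        lt_of_le_of_ne (flr_le hc ht₀ hs.1) fun e => hsX (e ▸ (flr_mem hc ht₀ s).1)
      refine (continuousWithinAt_const (b := f (flr X t₀ s))).congr_of_eventuallyEq ?_ rfl
      filter_upwards [mem_nhdsWithin_of_mem_nhds (Ioo_mem_nhds h2 h1)] with r hr
      rw [flr_eq hc hub ht₀ (flr_mem hc ht₀ s) hr.1.le hr.2]
  · intro s hs
    have hle := flr_le hc ht₀ hs.1
    by_cases hd : s < sigma X (flr X t₀ s)
    · refine (hasDerivWithinAt_const s _ (f (flr X t₀ s))).congr_of_eventuallyEq ?_ rfl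
      filter_upwards [self_mem_nhdsWithin, mem_nhdsWithin_of_mem_nhds (Iio_mem_nhds hd)]
        with r hr1 hr2
      rw [flr_eq hc hub ht₀ (flr_mem hc ht₀ s) (hle.trans hr1) hr2]
    · have hsX : s ∈ X := by
        by_contra h'
        exact hd (lt_sigma_flr hc hub ht₀ hs.1 h')
      have hsH : s ∈ halfLine X t₀ := ⟨hsX, hs.1⟩
      have hself := flr_eq_self hc ht₀ hsH
      have hds : sigma X s = s := by
        rw [hself] at hd
        exact le_antisymm (not_lt.1 hd) (le_sigma hub s)
      -- For `r ≥ s`, `flr r` lies between `s` and `r`, so the delta estimate at `flr r` carries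
      -- over to `r`.
      rw [hasDerivWithinAt_iff_isLittleO, Asymptotics.isLittleO_iff]
      intro ε hε
      obtain ⟨δ, hδ, h1⟩ := h s hsH ε hε
      have h2 := Metric.tendsto_nhdsWithin_nhds.1 (tendsto_flr hc hS ht₀ hsH hds) δ hδ
      obtain ⟨δ', hδ', h2⟩ := h2
      filter_upwards [self_mem_nhdsWithin, mem_nhdsWithin_of_mem_nhds (Metric.ball_mem_nhds s hδ')]
        with r hr1 hr2
      have hr0 : t₀ ≤ r := hs.1.trans hr1
      have h3 := h1 _ (flr_mem hc ht₀ r) (by simpa [Real.dist_eq] using h2 hr0 hr2)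
      have h4 : s ≤ flr X t₀ r := le_flr hsH hr1
      have h5 := flr_le hc ht₀ hr0
      rw [hds, smul_zero, sub_zero, norm_sub_rev, abs_sub_comm, abs_of_nonneg (by linarith)] at h3
      rw [smul_zero, sub_zero, hself, Real.norm_of_nonneg (by linarith [mem_Ici.1 hr1])]
      exact h3.trans (by gcongr)

theorem hasDeltaDerivAt_integral [CompleteSpace E] (hc : IsClosed X) (hub : ¬ BddAbove X)
    (hS : IsSturmian X t₀) (ht₀ : t₀ ∈ X) {g : ℝ → E} (hg : ContinuousOn g (halfLine X t₀))
    {t : ℝ} (ht : t ∈ halfLine X t₀) :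
    HasDeltaDerivAt X t₀ (fun t => ∫ s in t₀..t, g (flr X t₀ s)) (g t) t := by
  have hint := fun {a b : ℝ} => intervalIntegrable_comp_flr hc ht₀ hg (a := a) (b := b)
  refine (hasDeltaDerivAt_iff hub hS ht).2 ⟨fun hd => ?_, ?_⟩
  · rw [hasDerivWithinAt_iff_isLittleO, Asymptotics.isLittleO_iff]
    intro ε hε
    have h2 : Tendsto (fun s => g (flr X t₀ s)) (𝓝[Ici t₀] t) (𝓝 (g t)) :=
      (hg t ht).tendsto.comp
        (tendsto_nhdsWithin_iff.2 ⟨tendsto_flr hc hS ht₀ ht hd, .of_forall (flr_mem hc ht₀)⟩)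
    obtain ⟨δ, hδ, h2⟩ := Metric.tendsto_nhdsWithin_nhds.1 h2 ε hε
    filter_upwards [self_mem_nhdsWithin, mem_nhdsWithin_of_mem_nhds (Metric.ball_mem_nhds t hδ)]
      with s hs hst
    rw [intervalIntegral.integral_interval_sub_left (hint le_rfl hs.2) (hint le_rfl ht.2),
      ← intervalIntegral.integral_const, ← intervalIntegral.integral_sub (hint ht.2 hs.2)
        intervalIntegrable_const]
    refine intervalIntegral.norm_integral_le_of_norm_le_const fun r hr => ?_
    rw [← dist_eq_norm]
    refine (h2 ?_ ?_).le
    · exact le_trans (le_min ht.2 hs.2) hr.1.le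
    · refine lt_of_le_of_lt ?_ hst
      rw [Real.dist_eq, Real.dist_eq]
      exact abs_sub_left_of_mem_uIcc (uIoc_subset_uIcc hr)
  · have hσ := sigma_mem_halfLine (t₀ := t₀) hc hub ht
    rw [← intervalIntegral.integral_add_adjacent_intervals (hint le_rfl ht.2) (hint ht.2 hσ.2)]
    congr 1
    rw [intervalIntegral.integral_of_le (le_sigma hub t), integral_Ioc_eq_integral_Ioo,
      setIntegral_congr_fun measurableSet_Ioo (g := fun _ => g t)
        (fun s hs => by rw [flr_eq hc hub ht₀ ht hs.1.le hs.2])]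
    simp [mu, le_sigma hub t]

/-- The fundamental theorem of calculus on a Sturmian half-line. -/
theorem eq_add_integral_of_hasDeltaDerivAt [CompleteSpace E] (hc : IsClosed X)
    (hub : ¬ BddAbove X) (hS : IsSturmian X t₀) (ht₀ : t₀ ∈ X) {f g : ℝ → E}
    (hg : ContinuousOn g (halfLine X t₀))
    (h : ∀ t ∈ halfLine X t₀, HasDeltaDerivAt X t₀ f (g t) t) {a b : ℝ}
    (ha : a ∈ halfLine X t₀) (hb : b ∈ halfLine X t₀) :
    f b = f a + ∫ s in a..b, g (flr X t₀ s) := by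
  have hint := fun {a b : ℝ} => intervalIntegrable_comp_flr hc ht₀ hg (a := a) (b := b)
  have key : ∀ t ∈ halfLine X t₀, f t - ∫ s in t₀..t, g (flr X t₀ s) = f t₀ := by
    intro t ht
    have := eq_of_hasDeltaDerivAt_zero (f := fun t => f t - ∫ s in t₀..t, g (flr X t₀ s)) hc hub hS
      ht₀ (fun t ht => ?_) ht
    · simpa using this
    · obtain ⟨h1, h2⟩ := (hasDeltaDerivAt_iff hub hS ht).1 (h t ht)
      obtain ⟨h3, h4⟩ :=
        (hasDeltaDerivAt_iff hub hS ht).1 (hasDeltaDerivAt_integral hc hub hS ht₀ hg ht)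
      refine (hasDeltaDerivAt_iff hub hS ht).2 ⟨fun hd => ?_, ?_⟩
      · have h5 := (h1 hd).sub (h3 hd)
        rw [sub_self] at h5
        exact h5
      · simp only [h2, h4]
        module
  rw [← intervalIntegral.integral_interval_sub_left (hint le_rfl hb.2) (hint le_rfl ha.2)]
  have h1 := key a ha
  have h2 := key b hb
  rw [sub_eq_iff_eq_add] at h1 h2
  rw [h1, h2]
  abel

end Calculus

/-! ### Linear dynamic equations -/

section Existence

variable {ι : Type*} [Fintype ι]

theorem continuousOn_mulVec {κ : Type*} {s : Set ℝ} {K : ℝ → Matrix κ ι ℂ}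
    {v : ℝ → ι → ℂ} (hK : ContinuousOn K s) (hv : ContinuousOn v s) :
    ContinuousOn (fun t => (K t).mulVec (v t)) s := by
  rw [continuousOn_iff_continuous_domRestrict] at *
  exact Continuous.matrix_mulVec hK hv

theorem norm_mulVec_le (M : Matrix ι ι ℂ) (v : ι → ℂ) :
    ‖M.mulVec v‖ ≤ (∑ i, ∑ j, ‖M i j‖) * ‖v‖ := by
  rw [pi_norm_le_iff_of_nonneg (by positivity)]
  intro i
  calc ‖M.mulVec v i‖ ≤ ∑ j, ‖M i j * v j‖ := norm_sum_le _ _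
    _ ≤ ∑ j, ‖M i j‖ * ‖v‖ := by
      refine Finset.sum_le_sum fun j _ => ?_
      rw [norm_mul]
      gcongr
      exact norm_le_pi_norm v j
    _ = (∑ j, ‖M i j‖) * ‖v‖ := by rw [Finset.sum_mul]
    _ ≤ _ := by
      refine mul_le_mul_of_nonneg_right ?_ (norm_nonneg v)
      exact Finset.single_le_sum (f := fun i => ∑ j, ‖M i j‖) (fun i _ => by positivity)
        (Finset.mem_univ i)

theorem exists_mulVec_bound (hc : IsClosed X) {K : ℝ → Matrix ι ι ℂ}
    (hK : ContinuousOn K (halfLine X t₀)) (T : ℝ) :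
    ∃ L, 0 < L ∧ ∀ t ∈ halfLine X t₀, t ≤ T → ∀ v, ‖(K t).mulVec v‖ ≤ L * ‖v‖ := by
  have : ContinuousOn (fun t => ∑ i, ∑ j, ‖K t i j‖) (halfLine X t₀) := by
    refine continuousOn_finsetSum _ fun i _ => continuousOn_finsetSum _ fun j _ => ?_
    exact (continuousOn_pi.1 (continuousOn_pi.1 hK i) j).norm
  obtain ⟨C, hC0, hC⟩ := exists_norm_le hc this T
  refine ⟨C + 1, by positivity, fun t ht h v => (norm_mulVec_le _ v).trans ?_⟩
  gcongr
  exact (le_abs_self _).trans ((hC t ht h).trans (by linarith))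

/-- The terms of the Picard series of `u^Δ = K u`, `u(t₀) = c`. -/
noncomputable def picardTerm (X : Set ℝ) (t₀ : ℝ) (K : ℝ → Matrix ι ι ℂ) (c : ι → ℂ) :
    ℕ → ℝ → ι → ℂ
  | 0 => fun _ => c
  | k + 1 => fun t => ∫ s in t₀..t,
      (K (flr X t₀ s)).mulVec (picardTerm X t₀ K c k (flr X t₀ s))

theorem continuousOn_picardTerm (hc : IsClosed X) (hub : ¬ BddAbove X)
    (hS : IsSturmian X t₀) (ht₀ : t₀ ∈ X) {K : ℝ → Matrix ι ι ℂ}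
    (hK : ContinuousOn K (halfLine X t₀)) (c : ι → ℂ) (k : ℕ) :
    ContinuousOn (picardTerm X t₀ K c k) (halfLine X t₀) := by
  induction k with
  | zero => exact continuousOn_const
  | succ k ih =>
    exact continuousOn_of_hasDeltaDerivAt hub hS fun t ht =>
      ⟨_, hasDeltaDerivAt_integral (g := fun t => (K t).mulVec (picardTerm X t₀ K c k t)) hc hub hS
        ht₀ (continuousOn_mulVec hK ih) ht⟩

/-- Integrating `exp (2 L (t - t₀))` gains `1 / (2 L)` while `K` costs `L`, so in this exponential
weight each iteration halves the bound. -/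
theorem norm_picardTerm_le (hc : IsClosed X) (ht₀ : t₀ ∈ X) {K : ℝ → Matrix ι ι ℂ} (c : ι → ℂ)
    {L T : ℝ} (hL : 0 < L)
    (hKL : ∀ t ∈ halfLine X t₀, t ≤ T → ∀ v, ‖(K t).mulVec v‖ ≤ L * ‖v‖) (k : ℕ) {t : ℝ}
    (h0 : t₀ ≤ t) (hT : t ≤ T) :
    ‖picardTerm X t₀ K c k t‖ ≤ ‖c‖ * Real.exp (2 * L * (t - t₀)) * (1 / 2) ^ k := by
  induction k generalizing t with
  | zero =>
    have : 1 ≤ Real.exp (2 * L * (t - t₀)) :=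
      Real.one_le_exp (mul_nonneg (by positivity) (by linarith))
    simpa [picardTerm] using le_mul_of_one_le_right (norm_nonneg c) this
  | succ k ih =>
    have hder : ∀ s, HasDerivAt
        (fun s => ‖c‖ * Real.exp (2 * L * (s - t₀)) * (1 / 2) ^ (k + 1))
        (L * (‖c‖ * Real.exp (2 * L * (s - t₀)) * (1 / 2) ^ k)) s := by
      intro s
      have h1 : HasDerivAt (fun s => 2 * L * (s - t₀)) (2 * L) s := by
        simpa using ((hasDerivAt_id s).sub_const t₀).const_mul (2 * L)
      exact ((h1.exp.const_mul ‖c‖).mul_const ((1 / 2 : ℝ) ^ (k + 1))).congr_deriv (by ring)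
    have hcont : Continuous fun s => L * (‖c‖ * Real.exp (2 * L * (s - t₀)) * (1 / 2) ^ k) := by
      fun_prop
    have hb : ‖picardTerm X t₀ K c (k + 1) t‖ ≤
        ∫ s in t₀..t, L * (‖c‖ * Real.exp (2 * L * (s - t₀)) * (1 / 2) ^ k) := by
      refine intervalIntegral.norm_integral_le_of_norm_le h0 (.of_forall fun s hs => ?_)
        (hcont.intervalIntegrable _ _)
      have h1 := flr_le hc ht₀ hs.1.le
      have h2 := flr_mem hc ht₀ s
      refine (hKL _ h2 (h1.trans (hs.2.trans hT)) _).trans ?_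
      gcongr
      refine (ih h2.2 (h1.trans (hs.2.trans hT))).trans ?_
      gcongr
    rw [intervalIntegral.integral_eq_sub_of_hasDerivAt (fun s _ => hder s)
      (hcont.intervalIntegrable _ _)] at hb
    refine hb.trans (sub_le_self _ (by positivity))

/-- The Picard series converges locally uniformly, and dominated convergence gives the integral
equation, which is then differentiated. -/
theorem exists_linear_solution (hc : IsClosed X) (hub : ¬ BddAbove X)
    (hS : IsSturmian X t₀) (ht₀ : t₀ ∈ X) {K : ℝ → Matrix ι ι ℂ}
    (hK : ContinuousOn K (halfLine X t₀)) (c : ι → ℂ) :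
    ∃ u : ℝ → ι → ℂ, u t₀ = c ∧
      ∀ t ∈ halfLine X t₀, HasDeltaDerivAt X t₀ u ((K t).mulVec (u t)) t := by
  set φ := picardTerm X t₀ K c with hφ
  have hφc : ∀ k, ContinuousOn (φ k) (halfLine X t₀) :=
    continuousOn_picardTerm hc hub hS ht₀ hK c
  have hbound : ∀ T, ∃ L > 0, ∃ C, (∀ k t, t₀ ≤ t → t ≤ T → ‖φ k t‖ ≤ C * (1 / 2) ^ k) ∧
      ∀ t ∈ halfLine X t₀, t ≤ T → ∀ v, ‖(K t).mulVec v‖ ≤ L * ‖v‖ := by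
    intro T
    obtain ⟨L, hL, hKL⟩ := exists_mulVec_bound hc hK T
    refine ⟨L, hL, ‖c‖ * Real.exp (2 * L * (T - t₀)), fun k t h0 hT => ?_, hKL⟩
    refine (norm_picardTerm_le hc ht₀ c hL hKL k h0 hT).trans ?_
    gcongr
  have hgeom : ∀ C : ℝ, Summable fun k : ℕ => C * (1 / 2 : ℝ) ^ k := fun C =>
    (summable_geometric_of_lt_one (by norm_num) (by norm_num)).mul_left C
  have hsum : ∀ t, t₀ ≤ t → Summable fun k => φ k t := by
    intro t ht
    obtain ⟨L, -, C, hC, -⟩ := hbound t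
    exact Summable.of_norm_bounded (hgeom C) fun k => hC k t ht le_rfl
  let u : ℝ → ι → ℂ := fun t => ∑' k, φ k t
  have hu : ContinuousOn u (halfLine X t₀) := by
    intro t ht
    obtain ⟨L, -, C, hC, -⟩ := hbound (t + 1)
    have h1 : ContinuousOn u (halfLine X t₀ ∩ Iio (t + 1)) :=
      continuousOn_tsum (fun k => (hφc k).mono inter_subset_left) (hgeom C)
        fun k s hs => hC k s hs.1.2 hs.2.le
    exact (continuousWithinAt_inter (Iio_mem_nhds (by linarith))).1
      (h1 t ⟨ht, by simp⟩)
  have hKu : ContinuousOn (fun t => (K t).mulVec (u t)) (halfLine X t₀) :=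
    continuousOn_mulVec hK hu
  have heq : ∀ t, t₀ ≤ t →
      u t = c + ∫ s in t₀..t, (K (flr X t₀ s)).mulVec (u (flr X t₀ s)) := by
    intro t ht
    obtain ⟨L, hL, C, hC, hKL⟩ := hbound t
    have h1 : HasSum (fun k => φ (k + 1) t)
        (∫ s in t₀..t, (K (flr X t₀ s)).mulVec (u (flr X t₀ s))) := by
      refine intervalIntegral.hasSum_integral_of_dominated_convergence
        (fun k _ => L * (C * (1 / 2) ^ k)) (fun k => ?_) (fun k => .of_forall fun s hs => ?_)
        (.of_forall fun s _ => (hgeom C).mul_left L) intervalIntegrable_const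
        (.of_forall fun s hs => ?_)
      · exact (stronglyMeasurable_comp_flr hc ht₀ (f := fun t => (K t).mulVec (φ k t))
          (continuousOn_mulVec hK (hφc k))).aestronglyMeasurable
      · rw [uIoc_of_le ht] at hs
        have h2 := (flr_le hc ht₀ hs.1.le).trans hs.2
        have h3 := flr_mem hc ht₀ s
        refine (hKL _ h3 h2 _).trans ?_
        gcongr
        exact hC k _ h3.2 h2
      · exact (hsum _ (flr_mem hc ht₀ s).2).hasSum.map (K (flr X t₀ s)).mulVecLin
          (continuous_const.matrix_mulVec continuous_id)
    have h2 : u t = φ 0 t + ∑' k, φ (k + 1) t := (hsum t ht).tsum_eq_zero_add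
    rw [h2, h1.tsum_eq]
    rfl
  refine ⟨u, by simpa using heq t₀ le_rfl, fun t ht => ?_⟩
  obtain ⟨h3, h4⟩ :=
    (hasDeltaDerivAt_iff hub hS ht).1 (hasDeltaDerivAt_integral hc hub hS ht₀ hKu ht)
  refine (hasDeltaDerivAt_iff hub hS ht).2 ⟨fun hd => ?_, ?_⟩
  · exact ((h3 hd).const_add c).congr (fun s hs => heq s hs.2) (heq t ht.2)
  · rw [heq _ (sigma_mem_halfLine hc hub ht).2, heq t ht.2, add_assoc, h4, ← heq t ht.2]

end Existence

open Matrix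

/-! ### Solutions of the Hamiltonian system -/

variable {n : ℕ}

/-- The weight `diag(A₁, A₂)`. -/
abbrev weight (A₁ A₂ : ℝ → Matrix (Fin n) (Fin n) ℂ) (t : ℝ) : BlockMatrix n :=
  fromBlocks (A₁ t) 0 0 (A₂ t)

/-- The potential with blocks `B₁, B₂, B₃, B₄`. -/
abbrev potential (B₁ B₂ B₃ B₄ : ℝ → Matrix (Fin n) (Fin n) ℂ) (t : ℝ) : BlockMatrix n :=
  fromBlocks (B₁ t) (B₂ t) (B₃ t) (B₄ t)

/-- The standing assumptions on the time scale and on the coefficients. -/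
structure IsSystem (X : Set ℝ) (t₀ : ℝ) (A₁ A₂ B₁ B₂ B₃ B₄ : ℝ → Matrix (Fin n) (Fin n) ℂ) :
    Prop where
  closed : IsClosed X
  unbdd : ¬ BddAbove X
  mem : t₀ ∈ X
  sturm : IsSturmian X t₀
  contA₁ : ContinuousOn A₁ (halfLine X t₀)
  contA₂ : ContinuousOn A₂ (halfLine X t₀)
  contB₁ : ContinuousOn B₁ (halfLine X t₀)
  contB₂ : ContinuousOn B₂ (halfLine X t₀)
  contB₃ : ContinuousOn B₃ (halfLine X t₀)
  contB₄ : ContinuousOn B₄ (halfLine X t₀)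
  posSemidef : ∀ t ∈ halfLine X t₀, (weight A₁ A₂ t).PosSemidef
  isUnit₂ : ∀ t ∈ halfLine X t₀, IsUnit (1 + (mu X t : ℂ) • B₂ t)
  isUnit₃ : ∀ t ∈ halfLine X t₀, IsUnit (1 + (mu X t : ℂ) • B₃ t)

theorem continuousOn_fromBlocks {s : Set ℝ} {P Q R S : ℝ → Matrix (Fin n) (Fin n) ℂ}
    (hP : ContinuousOn P s) (hQ : ContinuousOn Q s) (hR : ContinuousOn R s)
    (hS : ContinuousOn S s) :
    ContinuousOn (fun t => fromBlocks (P t) (Q t) (R t) (S t)) s := by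
  rw [continuousOn_iff_continuous_domRestrict] at *
  exact Continuous.matrix_fromBlocks hP hQ hR hS

theorem continuousOn_conjTranspose {s : Set ℝ} {P : ℝ → Matrix (Fin n) (Fin n) ℂ}
    (hP : ContinuousOn P s) : ContinuousOn (fun t => (P t)ᴴ) s := by
  rw [continuousOn_iff_continuous_domRestrict] at *
  exact Continuous.matrix_conjTranspose hP

theorem continuousOn_inv {s : Set ℝ} {P : ℝ → Matrix (Fin n) (Fin n) ℂ}
    (hP : ContinuousOn P s) (hu : ∀ t ∈ s, IsUnit (P t)) : ContinuousOn (fun t => (P t)⁻¹) s := by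
  rw [continuousOn_iff_continuous_domRestrict] at *
  have h : ∀ t : s, (P t).det ≠ 0 := fun t => ((isUnit_iff_isUnit_det _).1 (hu t t.2)).ne_zero
  have : Continuous fun t : s => ((P t).det)⁻¹ • (P t).adjugate :=
    ((Continuous.matrix_det hP).inv₀ h).smul (Continuous.matrix_adjugate hP)
  refine this.congr fun t => ?_
  rw [domRestrict_apply, inv_def, Ring.inverse_eq_inv']

/-- The matrix that takes `ŷ(t)` to `y(t)` for solutions `y` of the system. -/
noncomputable def unshift (X : Set ℝ) (A₁ B₁ B₂ : ℝ → Matrix (Fin n) (Fin n) ℂ) (l : ℂ) (t : ℝ) :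
    BlockMatrix n :=
  fromBlocks 1 0 (-((mu X t : ℂ) • ((1 + (mu X t : ℂ) • B₂ t)⁻¹ * (l • A₁ t + B₁ t))))
    (1 + (mu X t : ℂ) • B₂ t)⁻¹

theorem hat_inl (y : ℝ → BlockVector n) (t : ℝ) (i : Fin n) :
    hat X y t (Sum.inl i) = y t (Sum.inl i) := rfl

theorem hat_inr (y : ℝ → BlockVector n) (t : ℝ) (i : Fin n) :
    hat X y t (Sum.inr i) = y (rho X t) (Sum.inr i) := rfl

theorem hat_eq_self (y : ℝ → BlockVector n) {t : ℝ} (h : rho X t = t) : hat X y t = y t := by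
  ext (i | i)
  · rfl
  · rw [hat_inr, h]

theorem matJ_mul_self : matJ n * matJ n = -1 := by
  simp [matJ, fromBlocks_multiply, ← fromBlocks_one, fromBlocks_neg]

theorem matJ_mulVec_inl (v : BlockVector n) (i : Fin n) :
    (matJ n).mulVec v (Sum.inl i) = -v (Sum.inr i) := by
  simp [matJ, fromBlocks_mulVec, neg_mulVec]

theorem matJ_mulVec_inr (v : BlockVector n) (i : Fin n) :
    (matJ n).mulVec v (Sum.inr i) = v (Sum.inl i) := by
  simp [matJ, fromBlocks_mulVec]

/-- A vector `w` equals `unshift v` as soon as `w₁ = v₁` and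
`w₂ + μ ((l A₁ + B₁) w₁ + B₂ w₂) = v₂`. -/
theorem eq_unshift_mulVec_iff {A₁ A₂ B₁ B₂ B₃ B₄ : ℝ → Matrix (Fin n) (Fin n) ℂ} {l : ℂ} {t : ℝ}
    (hu : IsUnit (1 + (mu X t : ℂ) • B₂ t)) (v w : BlockVector n) :
    w = (unshift X A₁ B₁ B₂ l t).mulVec v ↔
      (∀ i, w (Sum.inl i) = v (Sum.inl i)) ∧
      ∀ i, w (Sum.inr i) + (mu X t : ℂ) *
        ((l • weight A₁ A₂ t + potential B₁ B₂ B₃ B₄ t).mulVec w) (Sum.inl i) =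
          v (Sum.inr i) := by
  set P := 1 + (mu X t : ℂ) • B₂ t with hP
  have hdet := (isUnit_iff_isUnit_det _).1 hu
  have h1 : w = (unshift X A₁ B₁ B₂ l t).mulVec v ↔ (w ∘ Sum.inl = v ∘ Sum.inl) ∧
      w ∘ Sum.inr = P⁻¹ *ᵥ (v ∘ Sum.inr - (mu X t : ℂ) • (l • A₁ t + B₁ t) *ᵥ (v ∘ Sum.inl)) := by
    rw [unshift, fromBlocks_mulVec, ← hP]
    constructor
    · rintro rfl
      refine ⟨by ext; simp, ?_⟩
      rw [Sum.elim_comp_inr, mulVec_sub, neg_mulVec, smul_mulVec, mulVec_smul, mulVec_mulVec]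
      abel
    · rintro ⟨h1, h2⟩
      rw [← Sum.elim_comp_inl_inr w, h1, h2, mulVec_sub, neg_mulVec, smul_mulVec, mulVec_smul,
        mulVec_mulVec]
      congr 1
      · simp
      · abel
  have h2 : (l • weight A₁ A₂ t + potential B₁ B₂ B₃ B₄ t) =
      fromBlocks (l • A₁ t + B₁ t) (B₂ t) (B₃ t) (l • A₂ t + B₄ t) := by
    simp [weight, potential, fromBlocks_smul, fromBlocks_add]
  rw [h1, h2, fromBlocks_mulVec, funext_iff]
  refine and_congr_right fun h => ?_
  have h : w ∘ Sum.inl = v ∘ Sum.inl := funext h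
  have h3 : (∀ i, w (Sum.inr i) + (mu X t : ℂ) *
      (Sum.elim ((l • A₁ t + B₁ t) *ᵥ (w ∘ Sum.inl) + B₂ t *ᵥ (w ∘ Sum.inr))
        (B₃ t *ᵥ (w ∘ Sum.inl) + (l • A₂ t + B₄ t) *ᵥ (w ∘ Sum.inr))) (Sum.inl i) =
      v (Sum.inr i)) ↔
      P *ᵥ (w ∘ Sum.inr) = v ∘ Sum.inr - (mu X t : ℂ) • (l • A₁ t + B₁ t) *ᵥ (v ∘ Sum.inl) := by
    rw [funext_iff]
    refine forall_congr' fun i => ?_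
    rw [hP, add_mulVec 1, one_mulVec, smul_mulVec, h]
    simp only [Sum.elim_inl, Pi.add_apply, Pi.smul_apply, Pi.sub_apply, smul_eq_mul,
      Function.comp_apply]
    constructor <;> intro h <;> linear_combination h
  rw [h3]
  constructor
  · intro h4
    rw [h4, mulVec_mulVec, mul_nonsing_inv _ hdet, one_mulVec]
  · intro h4
    rw [← h4, mulVec_mulVec, nonsing_inv_mul _ hdet, one_mulVec]

/-- Changing the spectral parameter in `unshift`. -/
theorem unshift_eq (A₁ A₂ B₁ B₂ : ℝ → Matrix (Fin n) (Fin n) ℂ) (l l' : ℂ) (t : ℝ) :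
    unshift X A₁ B₁ B₂ l t =
      (1 + (l - l') • (matN X B₂ t * weight A₁ A₂ t)) * unshift X A₁ B₁ B₂ l' t := by
  simp only [unshift, matN, weight, fromBlocks_multiply, fromBlocks_smul, ← fromBlocks_one,
    fromBlocks_add]
  congr 1
  · simp
  · simp
  · simp only [zero_mul, mul_zero, add_zero, neg_mul, mul_one, one_mul, smul_mul_assoc, mul_add,
      mul_smul_comm, zero_add, smul_neg, smul_add, sub_smul, smul_zero]
    module
  · simp

/-- The bracket `ẑ^* J ŷ`. -/
noncomputable def bracket (X : Set ℝ) (z y : ℝ → BlockVector n) (t : ℝ) : ℂ :=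
  star (hat X z t) ⬝ᵥ (matJ n).mulVec (hat X y t)

theorem star_dotProduct_matJ (v w : BlockVector n) :
    star v ⬝ᵥ (matJ n).mulVec w =
      ∑ i, (star (v (Sum.inr i)) * w (Sum.inl i) - star (v (Sum.inl i)) * w (Sum.inr i)) := by
  rw [dotProduct, Fintype.sum_sum_type, ← Finset.sum_add_distrib]
  refine Finset.sum_congr rfl fun i _ => ?_
  rw [matJ_mulVec_inl, matJ_mulVec_inr, Pi.star_apply, Pi.star_apply]
  ring

/-- Since `ŷ₂(σ(t)) = y₂(t)` and likewise for `z`, the increment of `ẑ₂^* ŷ₁` at a scattered point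
is exactly `μ (z₂^* d₁ + e₂^* y₁)`: the shift absorbs the quadratic term in `μ`. At dense points `ŷ
= y` and this is the usual product rule. -/
theorem hasDeltaDerivAt_bracket (hub : ¬ BddAbove X) (hS : IsSturmian X t₀)
    {z y : ℝ → BlockVector n} {d e : BlockVector n} {t : ℝ} (ht : t ∈ halfLine X t₀)
    (hy : HasDeltaDerivAt X t₀ (hat X y) d t) (hz : HasDeltaDerivAt X t₀ (hat X z) e t) :
    HasDeltaDerivAt X t₀ (bracket X z y)
      (star (z t) ⬝ᵥ (matJ n).mulVec d - star ((matJ n).mulVec e) ⬝ᵥ y t) t := by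
  have hD : star (z t) ⬝ᵥ (matJ n).mulVec d - star ((matJ n).mulVec e) ⬝ᵥ y t =
      ∑ i, (star (e (Sum.inr i)) * y t (Sum.inl i) + star (z t (Sum.inr i)) * d (Sum.inl i) -
        (star (e (Sum.inl i)) * y t (Sum.inr i) + star (z t (Sum.inl i)) * d (Sum.inr i))) := by
    rw [star_dotProduct_matJ, dotProduct, Fintype.sum_sum_type, ← Finset.sum_add_distrib,
      ← Finset.sum_sub_distrib]
    refine Finset.sum_congr rfl fun i _ => ?_
    rw [Pi.star_apply, Pi.star_apply, matJ_mulVec_inl, matJ_mulVec_inr, star_neg]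
    ring
  have hb : bracket X z y = fun t => ∑ i, (star (hat X z t (Sum.inr i)) * hat X y t (Sum.inl i) -
      star (hat X z t (Sum.inl i)) * hat X y t (Sum.inr i)) :=
    funext fun t => star_dotProduct_matJ _ _
  obtain ⟨hy1, hy2⟩ := (hasDeltaDerivAt_iff hub hS ht).1 hy
  obtain ⟨hz1, hz2⟩ := (hasDeltaDerivAt_iff hub hS ht).1 hz
  rw [hD, hb]
  refine (hasDeltaDerivAt_iff hub hS ht).2 ⟨fun hd => ?_, ?_⟩
  · have hy1 := hasDerivWithinAt_pi.1 (hy1 hd)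
    have hz1 := hasDerivWithinAt_pi.1 (hz1 hd)
    rw [← hat_eq_self (X := X) y (hS.rho_eq ht hd), ← hat_eq_self (X := X) z (hS.rho_eq ht hd)]
    refine HasDerivWithinAt.fun_sum fun i _ => ?_
    exact ((hz1 _).star.mul (hy1 _)).sub ((hz1 _).star.mul (hy1 _))
  · rw [Finset.smul_sum, ← Finset.sum_add_distrib]
    refine Finset.sum_congr rfl fun i _ => ?_
    have h1 : ∀ v : ℝ → BlockVector n, hat X v (sigma X t) (Sum.inr i) = v t (Sum.inr i) :=
      fun v => by rw [hat_inr, (hS t ht).2]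
    have h2 := congr_fun hy2 (Sum.inr i)
    have h3 := congr_fun hz2 (Sum.inr i)
    rw [h1, Pi.add_apply, Pi.smul_apply] at h2 h3
    rw [h1, h1, hy2, hz2]
    simp only [Pi.add_apply, Pi.smul_apply, h2, h3, hat_inl, Complex.real_smul, star_add,
      star_mul', Complex.star_def, Complex.conj_ofReal]
    ring

theorem IsAdjointSolution.isSolution {A₁ A₂ B₁ B₂ B₃ B₄ : ℝ → Matrix (Fin n) (Fin n) ℂ}
    {l' : ℂ} {z : ℝ → BlockVector n}
    (hz : IsAdjointSolution X t₀ (weight A₁ A₂) (potential B₁ B₂ B₃ B₄) l' z) :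
    IsSolution X t₀ (weight A₁ A₂) (potential (fun t => (B₁ t)ᴴ) (fun t => (B₃ t)ᴴ)
      (fun t => (B₂ t)ᴴ) (fun t => (B₄ t)ᴴ)) (starRingEnd ℂ l') z := by
  simpa only [IsAdjointSolution, fromBlocks_conjTranspose] using hz

/-! ### Regularity and existence of solutions, Lagrange's identity -/

namespace IsSystem

variable {A₁ A₂ B₁ B₂ B₃ B₄ : ℝ → Matrix (Fin n) (Fin n) ℂ}
  (H : IsSystem X t₀ A₁ A₂ B₁ B₂ B₃ B₄)
include H

/-- Conjugate transposition exchanges the off-diagonal blocks, and with them the two invertibility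
assumptions. Results on the system thus apply to its adjoint. -/
theorem adjoint : IsSystem X t₀ A₁ A₂ (fun t => (B₁ t)ᴴ) (fun t => (B₃ t)ᴴ) (fun t => (B₂ t)ᴴ)
    (fun t => (B₄ t)ᴴ) where
  __ := H
  contB₁ := continuousOn_conjTranspose H.contB₁
  contB₂ := continuousOn_conjTranspose H.contB₃
  contB₃ := continuousOn_conjTranspose H.contB₂
  contB₄ := continuousOn_conjTranspose H.contB₄
  isUnit₂ t ht := by simpa [star_eq_conjTranspose] using (H.isUnit₃ t ht).star
  isUnit₃ t ht := by simpa [star_eq_conjTranspose] using (H.isUnit₂ t ht).star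

theorem continuousOn_weight : ContinuousOn (weight A₁ A₂) (halfLine X t₀) :=
  continuousOn_fromBlocks H.contA₁ continuousOn_const continuousOn_const H.contA₂

theorem continuousOn_potential : ContinuousOn (potential B₁ B₂ B₃ B₄) (halfLine X t₀) :=
  continuousOn_fromBlocks H.contB₁ H.contB₂ H.contB₃ H.contB₄

theorem continuousOn_unshift (l : ℂ) :
    ContinuousOn (unshift X A₁ B₁ B₂ l) (halfLine X t₀) := by
  have hmu : ContinuousOn (fun t => (mu X t : ℂ)) (halfLine X t₀) :=
    Complex.continuous_ofReal.comp_continuousOn (continuousOn_mu H.unbdd H.sturm)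
  have hinv : ContinuousOn (fun t => (1 + (mu X t : ℂ) • B₂ t)⁻¹) (halfLine X t₀) :=
    continuousOn_inv (continuousOn_const.add (hmu.smul H.contB₂)) H.isUnit₂
  refine continuousOn_fromBlocks continuousOn_const continuousOn_const ?_ hinv
  exact (hmu.smul (hinv.mul ((H.contA₁.const_smul l).add H.contB₁))).neg

/-- The second block of the jump formula reads `y₂(t) = ŷ₂(t) + μ d₂`, where `-d₂` is the first
block of `(l A + B) y`; this is solved for `y₂`. -/
theorem eq_unshift {l : ℂ} {y : ℝ → BlockVector n}
    (hy : IsSolution X t₀ (weight A₁ A₂) (potential B₁ B₂ B₃ B₄) l y) {t : ℝ}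
    (ht : t ∈ halfLine X t₀) : y t = (unshift X A₁ B₁ B₂ l t).mulVec (hat X y t) := by
  obtain ⟨d, hd, hJ⟩ := hy t ht
  have h2 := ((hasDeltaDerivAt_iff H.unbdd H.sturm ht).1 hd).2
  rw [eq_unshift_mulVec_iff (A₂ := A₂) (B₃ := B₃) (B₄ := B₄) (H.isUnit₂ t ht)]
  refine ⟨fun i => rfl, fun i => ?_⟩
  have h3 := congr_fun h2 (Sum.inr i)
  rw [hat_inr, (H.sturm t ht).2, Pi.add_apply, Pi.smul_apply, Complex.real_smul] at h3
  rw [← hJ, matJ_mulVec_inl, h3]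
  ring

theorem continuousOn_hat {l : ℂ} {y : ℝ → BlockVector n}
    (hy : IsSolution X t₀ (weight A₁ A₂) (potential B₁ B₂ B₃ B₄) l y) :
    ContinuousOn (hat X y) (halfLine X t₀) :=
  continuousOn_of_hasDeltaDerivAt H.unbdd H.sturm fun t ht => by
    obtain ⟨d, hd, -⟩ := hy t ht
    exact ⟨d, hd⟩

theorem continuousOn_solution {l : ℂ} {y : ℝ → BlockVector n}
    (hy : IsSolution X t₀ (weight A₁ A₂) (potential B₁ B₂ B₃ B₄) l y) :
    ContinuousOn y (halfLine X t₀) :=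
  (continuousOn_mulVec (H.continuousOn_unshift l) (H.continuousOn_hat hy)).congr
    fun _ ht => H.eq_unshift hy ht

/-- As `J⁻¹ = -J` and `y` is `unshift` applied to `ŷ`, the system is a linear equation for `u = ŷ`.
The shift is undone by `y₂ = u₂ ∘ σ`, because `σ(ρ(t)) = t`. -/
theorem exists_solution (l : ℂ) (c : BlockVector n) :
    ∃ y, IsSolution X t₀ (weight A₁ A₂) (potential B₁ B₂ B₃ B₄) l y ∧ hat X y t₀ = c := by
  have h0 : t₀ ∈ halfLine X t₀ := ⟨H.mem, self_mem_Ici⟩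
  set S : ℝ → BlockMatrix n := fun t => l • weight A₁ A₂ t + potential B₁ B₂ B₃ B₄ t with hS
  have hSc : ContinuousOn S (halfLine X t₀) :=
    (H.continuousOn_weight.const_smul l).add H.continuousOn_potential
  obtain ⟨u, hu0, hu⟩ := exists_linear_solution H.closed H.unbdd H.sturm H.mem
    (K := fun t => -(matJ n * S t * unshift X A₁ B₁ B₂ l t))
    ((continuousOn_const.mul hSc).mul (H.continuousOn_unshift l)).neg c
  let y : ℝ → BlockVector n := fun t =>
    Sum.elim (fun i => u t (Sum.inl i)) (fun i => u (sigma X t) (Sum.inr i))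
  have hhat : ∀ t ∈ halfLine X t₀, hat X y t = u t := by
    intro t ht
    ext (i | i)
    · rfl
    · rw [hat_inr]
      change u (sigma X (rho X t)) _ = _
      rw [(H.sturm t ht).1]
  refine ⟨y, fun t ht =>
    ⟨(-(matJ n * S t * unshift X A₁ B₁ B₂ l t)).mulVec (u t), ?_, ?_⟩, (hhat t₀ h0).trans hu0⟩
  · intro ε hε
    obtain ⟨δ, hδ, h⟩ := hu t ht ε hε
    refine ⟨δ, hδ, fun s hs hst => ?_⟩
    rw [hhat s hs, hhat _ (sigma_mem_halfLine H.closed H.unbdd ht)]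
    exact h s hs hst
  · have h1 : (matJ n).mulVec ((-(matJ n * S t * unshift X A₁ B₁ B₂ l t)).mulVec (u t)) =
        (S t).mulVec ((unshift X A₁ B₁ B₂ l t).mulVec (u t)) := by
      rw [mulVec_mulVec, mulVec_mulVec, mul_neg, mul_assoc, ← mul_assoc (matJ n), matJ_mul_self,
        neg_one_mul, neg_neg]
    rw [h1]
    -- It remains to see that `y t` is `unshift` applied to `u t`; the second block follows from the
    -- jump formula for `u`.
    congr 1
    have h2 := ((hasDeltaDerivAt_iff H.unbdd H.sturm ht).1 (hu t ht)).2
    have h3 := (eq_unshift_mulVec_iff (A₁ := A₁) (A₂ := A₂) (B₁ := B₁) (B₃ := B₃) (B₄ := B₄)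
      (l := l) (H.isUnit₂ t ht) (u t) _).1 rfl
    ext (i | i)
    · exact h3.1 i
    · have h4 := h3.2 i
      have h5 := congr_fun h1 (Sum.inl i)
      have h6 := congr_fun h2 (Sum.inr i)
      rw [matJ_mulVec_inl] at h5
      rw [Pi.add_apply, Pi.smul_apply, Complex.real_smul] at h6
      change _ = u (sigma X t) (Sum.inr i)
      rw [h6, ← h4]
      linear_combination (mu X t : ℂ) * h5

/-- Lagrange's identity. -/
theorem hasDeltaDerivAt_lagrange {l l' : ℂ} {y z : ℝ → BlockVector n}
    (hy : IsSolution X t₀ (weight A₁ A₂) (potential B₁ B₂ B₃ B₄) l y)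
    (hz : IsAdjointSolution X t₀ (weight A₁ A₂) (potential B₁ B₂ B₃ B₄) l' z) {t : ℝ}
    (ht : t ∈ halfLine X t₀) :
    HasDeltaDerivAt X t₀ (bracket X z y)
      ((l - l') * (star (z t) ⬝ᵥ (weight A₁ A₂ t).mulVec (y t))) t := by
  obtain ⟨d, hd, hJd⟩ := hy t ht
  obtain ⟨e, he, hJe⟩ := hz t ht
  convert hasDeltaDerivAt_bracket H.unbdd H.sturm ht hd he using 1
  rw [hJd, hJe, star_mulVec, ← dotProduct_mulVec, conjTranspose_add, conjTranspose_smul,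
    conjTranspose_conjTranspose, (H.posSemidef t ht).isHermitian.eq, ← dotProduct_sub,
    ← sub_mulVec, add_sub_add_right_eq_sub, ← Complex.star_def, star_star, ← sub_smul,
    smul_mulVec, dotProduct_smul, smul_eq_mul]

end IsSystem

/-! ### The seminorm of a positive semidefinite matrix -/

section Seminorm

variable {ι : Type*} [Fintype ι] [DecidableEq ι]

/-- `‖M^{1/2} v‖`. -/
noncomputable def wnorm (M : Matrix ι ι ℂ) (v : ι → ℂ) : ℝ :=
  ‖WithLp.toLp 2 ((CFC.sqrt M).mulVec v)‖

theorem wnorm_nonneg (M : Matrix ι ι ℂ) (v : ι → ℂ) : 0 ≤ wnorm M v := norm_nonneg _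

theorem conjTranspose_sqrt (M : Matrix ι ι ℂ) : (CFC.sqrt M)ᴴ = CFC.sqrt M :=
  (IsSelfAdjoint.of_nonneg (CFC.sqrt_nonneg M)).star_eq

theorem sqrt_mul_sqrt {M : Matrix ι ι ℂ} (hM : M.PosSemidef) : CFC.sqrt M * CFC.sqrt M = M :=
  CFC.sqrt_mul_sqrt_self M hM.nonneg

theorem star_dotProduct_mulVec_eq_inner {M : Matrix ι ι ℂ} (hM : M.PosSemidef) (v w : ι → ℂ) :
    star v ⬝ᵥ M.mulVec w = inner ℂ (WithLp.toLp 2 ((CFC.sqrt M).mulVec v))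
      (WithLp.toLp 2 ((CFC.sqrt M).mulVec w)) := by
  rw [EuclideanSpace.inner_eq_star_dotProduct, dotProduct_comm _ (star _), star_mulVec, conjTranspose_sqrt,
    ← dotProduct_mulVec, mulVec_mulVec, sqrt_mul_sqrt hM]

theorem norm_star_dotProduct_mulVec_le {M : Matrix ι ι ℂ} (hM : M.PosSemidef) (v w : ι → ℂ) :
    ‖star v ⬝ᵥ M.mulVec w‖ ≤ wnorm M v * wnorm M w := by
  rw [star_dotProduct_mulVec_eq_inner hM]
  exact norm_inner_le_norm _ _

theorem star_dotProduct_mulVec_self {M : Matrix ι ι ℂ} (hM : M.PosSemidef) (v : ι → ℂ) :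
    star v ⬝ᵥ M.mulVec v = ((wnorm M v ^ 2 : ℝ) : ℂ) := by
  rw [star_dotProduct_mulVec_eq_inner hM, inner_self_eq_norm_sq_to_K, wnorm]
  push_cast
  rfl

theorem wnorm_sum_le {κ : Type*} [Fintype κ] (M : Matrix ι ι ℂ) (c : κ → ℂ) (v : κ → ι → ℂ) :
    wnorm M (∑ j, c j • v j) ≤ ∑ j, ‖c j‖ * wnorm M (v j) := by
  rw [wnorm, mulVec_sum, WithLp.toLp_sum]
  refine (norm_sum_le _ _).trans (Finset.sum_le_sum fun j _ => ?_)
  rw [mulVec_smul, WithLp.toLp_smul, norm_smul, wnorm]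

/-- `M^{1/2} (1 + k N M) = (1 + k M^{1/2} N M^{1/2}) M^{1/2}`, so only the two-sided product needs a
bound. -/
theorem wnorm_one_add_le {M N : Matrix ι ι ℂ} (hM : M.PosSemidef)
    (h : ∀ v, ‖WithLp.toLp 2 ((CFC.sqrt M * N * CFC.sqrt M).mulVec v)‖ ≤ ‖WithLp.toLp 2 v‖)
    (k : ℂ) (v : ι → ℂ) :
    wnorm M ((1 + k • (N * M)).mulVec v) ≤ (1 + ‖k‖) * wnorm M v := by
  have h1 : (CFC.sqrt M).mulVec ((1 + k • (N * M)).mulVec v) = (CFC.sqrt M).mulVec v +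
      k • (CFC.sqrt M * N * CFC.sqrt M).mulVec ((CFC.sqrt M).mulVec v) := by
    rw [mulVec_mulVec, mulVec_mulVec, mul_assoc _ (CFC.sqrt M) (CFC.sqrt M), sqrt_mul_sqrt hM,
      ← smul_mulVec, ← add_mulVec, mul_add, mul_one, mul_smul_comm, mul_assoc]
  rw [wnorm, h1, WithLp.toLp_add, WithLp.toLp_smul, add_mul, one_mul, wnorm]
  refine (norm_add_le _ _).trans ?_
  rw [norm_smul]
  gcongr
  exact h _

open scoped Matrix.Norms.L2Operator in
-- By the C*-identity `‖W^* W‖ = ‖W‖²`, the operator norm of `W` is eventually at most `1`.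
theorem eventually_norm_mulVec_le {β : Type*} {F : Filter β} {W : β → Matrix ι ι ℂ}
    (h : Tendsto (fun b => (W b)ᴴ * W b) F (𝓝 0)) :
    ∀ᶠ b in F, ∀ v, ‖WithLp.toLp 2 ((W b).mulVec v)‖ ≤ ‖WithLp.toLp 2 v‖ := by
  have h1 : Tendsto (fun b => ‖(W b)ᴴ * W b‖) F (𝓝 0) := by simpa using h.norm
  filter_upwards [h1.eventually_lt_const one_pos] with b hb v
  rw [l2_opNorm_conjTranspose_mul_self] at hb
  have h2 : ‖W b‖ ≤ 1 := by
    by_contra! h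
    nlinarith
  have h3 := l2_opNorm_mulVec (W b) (WithLp.toLp 2 v)
  exact h3.trans (mul_le_of_le_one_left (norm_nonneg _) h2)

end Seminorm

/-! ### Boundedness from an integral inequality with integrable kernel -/

/-- Choose `t₁` so that the kernel has integral at most `1/2` beyond it. If `‖d‖` attains its
maximum over `[t₁, t]_X` at `m`, then `‖d m‖ ≤ ‖d t₁‖ + ‖d m‖ / 2`, hence `‖d m‖ ≤ 2 ‖d t₁‖`. -/
theorem exists_norm_le_of_integral_ineq {E : Type*} [NormedAddCommGroup E] (hc : IsClosed X)
    (hub : ¬ BddAbove X) (ht₀ : t₀ ∈ X) {d : ℝ → E} {γ : ℝ → ℝ} {T : ℝ}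
    (hd : ContinuousOn d (halfLine X t₀)) (hγ : ContinuousOn γ (halfLine X t₀))
    (hγ0 : ∀ t, 0 ≤ γ t) (hint : IntegrableOn (fun s => γ (flr X t₀ s)) (Ici t₀))
    (h : ∀ a ∈ halfLine X t₀, ∀ b ∈ halfLine X t₀, T ≤ a → a ≤ b →
      ‖d b‖ ≤ ‖d a‖ + ∫ s in a..b, γ (flr X t₀ s) * ‖d (flr X t₀ s)‖) :
    ∃ C, ∀ t ∈ halfLine X t₀, ‖d t‖ ≤ C := by
  have hI := fun {a b : ℝ} => intervalIntegrable_comp_flr hc ht₀ hγ (a := a) (b := b)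
  have hint' : IntegrableOn (fun s => γ (flr X t₀ s)) (Ioi t₀) := hint.mono_set Ioi_subset_Ici_self
  have hlim := intervalIntegral_tendsto_integral_Ioi t₀ hint' tendsto_id
  obtain ⟨T', hT'⟩ := (eventually_atTop.1 (hlim.eventually_const_lt
    (sub_lt_self (∫ s in Ioi t₀, γ (flr X t₀ s)) (by norm_num : (0 : ℝ) < 1 / 2))))
  obtain ⟨t₁, ht₁, hT₁⟩ := exists_mem_gt hub (max (max T T') t₀)
  obtain ⟨hT₁, h01⟩ := max_lt_iff.1 (mem_Ioi.1 hT₁)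
  obtain ⟨hT1, hT1'⟩ := max_lt_iff.1 hT₁
  have ht₁H : t₁ ∈ halfLine X t₀ := ⟨ht₁, h01.le⟩
  have htail : ∀ b, t₁ ≤ b → ∫ s in t₁..b, γ (flr X t₀ s) ≤ 1 / 2 := by
    intro b hb
    have h1 := hT' t₁ hT1'.le
    have h2 : ∫ s in t₀..b, γ (flr X t₀ s) ≤ ∫ s in Ioi t₀, γ (flr X t₀ s) := by
      rw [intervalIntegral.integral_of_le (h01.le.trans hb)]
      exact setIntegral_mono_set hint' (.of_forall fun s => hγ0 _)
        (LE.le.eventuallyLE Ioc_subset_Ioi_self)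
    rw [← intervalIntegral.integral_interval_sub_left (hI le_rfl (h01.le.trans hb))
      (hI le_rfl h01.le)]
    simp only [id] at h1
    linarith
  obtain ⟨C, -, hC⟩ := exists_norm_le hc hd t₁
  refine ⟨max C (2 * ‖d t₁‖), fun t ht => ?_⟩
  rcases le_total t t₁ with hle | hle
  · exact (hC t ht hle).trans (le_max_left _ _)
  refine le_trans ?_ (le_max_right _ _)
  have hK : IsCompact (halfLine X t₀ ∩ Icc t₁ t) := isCompact_Icc.inter_left (isClosed_halfLine hc)
  obtain ⟨m, hm, hmax⟩ := hK.exists_isMaxOn ⟨t, ht, hle, le_rfl⟩ (hd.mono inter_subset_left).norm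
  have hmax : ∀ s ∈ halfLine X t₀ ∩ Icc t₁ t, ‖d s‖ ≤ ‖d m‖ := hmax
  have h1 := h t₁ ht₁H m hm.1 hT1.le hm.2.1
  have h2 : ∫ s in t₁..m, γ (flr X t₀ s) * ‖d (flr X t₀ s)‖ ≤
      ∫ s in t₁..m, γ (flr X t₀ s) * ‖d m‖ := by
    refine intervalIntegral.integral_mono_on hm.2.1
      (intervalIntegrable_comp_flr (f := fun t => γ t * ‖d t‖) hc ht₀ (hγ.mul hd.norm) h01.le
        hm.1.2) ((hI h01.le hm.1.2).mul_const _) fun s hs => ?_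
    refine mul_le_mul_of_nonneg_left (hmax _ ⟨flr_mem hc ht₀ s, le_flr ht₁H hs.1, ?_⟩) (hγ0 _)
    exact (flr_le hc ht₀ (h01.le.trans hs.1)).trans (hs.2.trans hm.2.2)
  rw [intervalIntegral.integral_mul_const] at h2
  have h3 := mul_le_mul_of_nonneg_right (htail m hm.2.1) (norm_nonneg (d m))
  have h4 := hmax t ⟨ht, hle, le_rfl⟩
  linarith

theorem integrableOn_mul_of_sq (hc : IsClosed X) (ht₀ : t₀ ∈ X) {f g : ℝ → ℝ}
    (hf : ContinuousOn f (halfLine X t₀)) (hg : ContinuousOn g (halfLine X t₀))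
    (hf2 : IntegrableOn (fun s => f (flr X t₀ s) ^ 2) (Ici t₀))
    (hg2 : IntegrableOn (fun s => g (flr X t₀ s) ^ 2) (Ici t₀)) :
    IntegrableOn (fun s => f (flr X t₀ s) * g (flr X t₀ s)) (Ici t₀) := by
  refine (hf2.add hg2).mono'
    (stronglyMeasurable_comp_flr (f := fun t => f t * g t) hc ht₀ (hf.mul hg)).aestronglyMeasurable
    (.of_forall fun s => ?_)
  rw [Real.norm_eq_abs, abs_le, Pi.add_apply]
  constructor <;> nlinarith [sq_nonneg (f (flr X t₀ s) + g (flr X t₀ s)),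
    sq_nonneg (f (flr X t₀ s) - g (flr X t₀ s)), sq_nonneg (f (flr X t₀ s)),
    sq_nonneg (g (flr X t₀ s))]

/-! ### Square integrability and change of the spectral parameter -/

namespace IsSystem

variable {A₁ A₂ B₁ B₂ B₃ B₄ : ℝ → Matrix (Fin n) (Fin n) ℂ}
  (H : IsSystem X t₀ A₁ A₂ B₁ B₂ B₃ B₄)
include H

theorem continuousOn_quadratic {v w : ℝ → BlockVector n} (hv : ContinuousOn v (halfLine X t₀))
    (hw : ContinuousOn w (halfLine X t₀)) :
    ContinuousOn (fun t => star (v t) ⬝ᵥ (weight A₁ A₂ t).mulVec (w t)) (halfLine X t₀) := by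
  have h := continuousOn_mulVec H.continuousOn_weight hw
  rw [continuousOn_iff_continuous_domRestrict] at *
  exact Continuous.dotProduct hv.star h

/-- Writing the seminorm as the root of the quadratic form avoids continuity of the matrix square
root. -/
theorem continuousOn_wnorm {v : ℝ → BlockVector n} (hv : ContinuousOn v (halfLine X t₀)) :
    ContinuousOn (fun t => wnorm (weight A₁ A₂ t) (v t)) (halfLine X t₀) := by
  refine (H.continuousOn_quadratic hv hv).norm.sqrt.congr fun t ht => ?_
  dsimp only
  rw [star_dotProduct_mulVec_self (H.posSemidef t ht), Complex.norm_real,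
    Real.norm_of_nonneg (sq_nonneg _), Real.sqrt_sq (wnorm_nonneg _ _)]

theorem isSquareIntegrable_iff {v : ℝ → BlockVector n} (hv : ContinuousOn v (halfLine X t₀)) :
    IsSquareIntegrable X t₀ (weight A₁ A₂) v ↔
      IntegrableOn (fun s => wnorm (weight A₁ A₂ (flr X t₀ s)) (v (flr X t₀ s)) ^ 2) (Ici t₀) := by
  have hq := H.continuousOn_quadratic hv hv
  rw [IsSquareIntegrable,
    and_iff_right (aestronglyMeasurable_deltaMeasure H.closed H.unbdd H.mem hv),
    integrable_deltaMeasure_iff H.closed H.unbdd H.mem hq, IntegrableOn, ← integrable_norm_iff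
      (stronglyMeasurable_comp_flr H.closed H.mem hq).aestronglyMeasurable]
  refine integrable_congr (.of_forall fun s => ?_)
  simp only [star_dotProduct_mulVec_self (H.posSemidef _ (flr_mem H.closed H.mem s)),
    Complex.norm_real, Real.norm_of_nonneg (sq_nonneg _)]

/-- Fundamental systems of solutions of the system and of its adjoint, biorthogonal with respect
to the bracket, and the resulting expansion of solutions for other parameters. -/
theorem exists_fundamental (l' : ℂ) :
    ∃ Y Z : Fin n ⊕ Fin n → ℝ → BlockVector n,
      (∀ j, IsSolution X t₀ (weight A₁ A₂) (potential B₁ B₂ B₃ B₄) l' (Y j)) ∧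
      (∀ j, IsAdjointSolution X t₀ (weight A₁ A₂) (potential B₁ B₂ B₃ B₄) l' (Z j)) ∧
      ∀ y : ℝ → BlockVector n, ∀ t ∈ halfLine X t₀,
        hat X y t = ∑ j, (-(matJ n).mulVec fun j => bracket X (Z j) y t) j • hat X (Y j) t := by
  choose Y hY hY0 using fun j : Fin n ⊕ Fin n => H.exists_solution l' (Pi.single j 1)
  choose Z hZ hZ0 using fun j : Fin n ⊕ Fin n =>
    H.adjoint.exists_solution (starRingEnd ℂ l') (Pi.single j 1)
  have hZ : ∀ j, IsAdjointSolution X t₀ (weight A₁ A₂) (potential B₁ B₂ B₃ B₄) l' (Z j) :=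
    fun j => by simpa only [IsAdjointSolution, fromBlocks_conjTranspose] using hZ j
  refine ⟨Y, Z, hY, hZ, fun y t ht => ?_⟩
  -- For equal parameters Lagrange's identity gives a zero derivative, and at `t₀` the unit vectors
  -- pick out the entries of `J`.
  have hconst : ∀ j k, bracket X (Z j) (Y k) t = matJ n j k := by
    intro j k
    rw [eq_of_hasDeltaDerivAt_zero (f := bracket X (Z j) (Y k)) H.closed H.unbdd H.sturm H.mem
      (fun t ht => by simpa using H.hasDeltaDerivAt_lagrange (hY k) (hZ j) ht) ht, bracket, hY0,
      hZ0, ← Pi.single_star, star_one, mulVec_single_one, single_one_dotProduct]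
    rfl
  let P : BlockMatrix n := of fun i j => hat X (Y j) t i
  let Q : BlockMatrix n := of fun j i => star (hat X (Z j) t i)
  have hQ : ∀ v : ℝ → BlockVector n, Q *ᵥ (matJ n *ᵥ hat X v t) =
      fun j => bracket X (Z j) v t := fun v => rfl
  have h1 : Q * matJ n * P = matJ n := by
    ext j k
    rw [← hconst j k]
    have := congr_fun (hQ (Y k)) j
    rw [← this, mulVec_mulVec]
    rfl
  -- For square matrices the left inverse `-J Q J` of `P` is also a right inverse, which yields the
  -- expansion of an arbitrary vector.
  have h2 : P * (-(matJ n) * (Q * matJ n)) = 1 := by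
    rw [mul_eq_one_comm, mul_assoc, h1, neg_mul, matJ_mul_self, neg_neg]
  have h3 : P *ᵥ (-(matJ n *ᵥ fun j => bracket X (Z j) y t)) = hat X y t := by
    rw [← hQ y, ← neg_mulVec, mulVec_mulVec, mulVec_mulVec, mulVec_mulVec, mul_assoc,
      mul_assoc, h2, one_mulVec]
  conv_lhs => rw [← h3]
  ext i
  simp only [mulVec, dotProduct, Finset.sum_apply, Pi.smul_apply, smul_eq_mul]
  exact Finset.sum_congr rfl fun j _ => mul_comm _ _

/-- `y` and the `Y j` are recovered from their shifts by `unshift` at different parameters;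
`unshift_eq` supplies the correction factor containing `N`. -/
theorem eq_mulVec_sum {l l' : ℂ} {κ : Type*} [Fintype κ] {y : ℝ → BlockVector n}
    {Y : κ → ℝ → BlockVector n} {c : κ → ℂ}
    (hy : IsSolution X t₀ (weight A₁ A₂) (potential B₁ B₂ B₃ B₄) l y)
    (hY : ∀ j, IsSolution X t₀ (weight A₁ A₂) (potential B₁ B₂ B₃ B₄) l' (Y j)) {t : ℝ}
    (ht : t ∈ halfLine X t₀) (h : hat X y t = ∑ j, c j • hat X (Y j) t) :
    y t = (1 + (l - l') • (matN X B₂ t * weight A₁ A₂ t)).mulVec (∑ j, c j • Y j t) := by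
  rw [H.eq_unshift hy ht, unshift_eq A₁ A₂ B₁ B₂ l l' t, ← mulVec_mulVec, h, mulVec_sum]
  congr 1
  refine Finset.sum_congr rfl fun j _ => ?_
  rw [mulVec_smul, ← H.eq_unshift (hY j) ht]

/-- Invariance of the limit circle case under a change of the spectral parameter. -/
theorem isSquareIntegrable_of_isSolution {l' : ℂ}
    (hsol : ∀ y, IsSolution X t₀ (weight A₁ A₂) (potential B₁ B₂ B₃ B₄) l' y →
      IsSquareIntegrable X t₀ (weight A₁ A₂) y)
    (hadj : ∀ z, IsAdjointSolution X t₀ (weight A₁ A₂) (potential B₁ B₂ B₃ B₄) l' z →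
      IsSquareIntegrable X t₀ (weight A₁ A₂) z)
    (hlim : Tendsto (fun t => CFC.sqrt (weight A₁ A₂ t) * (matN X B₂ t)ᴴ * weight A₁ A₂ t *
      matN X B₂ t * CFC.sqrt (weight A₁ A₂ t)) (atTop ⊓ 𝓟 (halfLine X t₀)) (𝓝 0))
    {l : ℂ} {y : ℝ → BlockVector n}
    (hy : IsSolution X t₀ (weight A₁ A₂) (potential B₁ B₂ B₃ B₄) l y) :
    IsSquareIntegrable X t₀ (weight A₁ A₂) y := by
  obtain ⟨Y, Z, hY, hZ, hexp⟩ := H.exists_fundamental l'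
  have hyc := H.continuousOn_solution hy
  have hYc := fun j => H.continuousOn_solution (hY j)
  have hZc := fun j => H.adjoint.continuousOn_solution (hZ j).isSolution
  have hY2 := fun j => (H.isSquareIntegrable_iff (hYc j)).1 (hsol _ (hY j))
  have hZ2 := fun j => (H.isSquareIntegrable_iff (hZc j)).1 (hadj _ (hZ j))
  let a : Fin n ⊕ Fin n → ℝ → ℝ := fun j t => wnorm (weight A₁ A₂ t) (Y j t)
  let b : Fin n ⊕ Fin n → ℝ → ℝ := fun j t => wnorm (weight A₁ A₂ t) (Z j t)
  have hac : ∀ j, ContinuousOn (a j) (halfLine X t₀) := fun j => H.continuousOn_wnorm (hYc j)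
  have hbc : ∀ j, ContinuousOn (b j) (halfLine X t₀) := fun j => H.continuousOn_wnorm (hZc j)
  have ha0 : ∀ j t, 0 ≤ a j t := fun j t => wnorm_nonneg _ _
  have hb0 : ∀ j t, 0 ≤ b j t := fun j t => wnorm_nonneg _ _
  let α : ℝ → ℝ := fun t => ∑ j, a j t
  let β : ℝ → ℝ := fun t => ∑ j, b j t
  have hαc : ContinuousOn α (halfLine X t₀) := continuousOn_finsetSum _ fun j _ => hac j
  have hβc : ContinuousOn β (halfLine X t₀) := continuousOn_finsetSum _ fun j _ => hbc j
  have hα0 : ∀ t, 0 ≤ α t := fun t => Finset.sum_nonneg fun j _ => ha0 j t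
  have hβ0 : ∀ t, 0 ≤ β t := fun t => Finset.sum_nonneg fun j _ => hb0 j t
  have hαα : IntegrableOn (fun s => α (flr X t₀ s) * α (flr X t₀ s)) (Ici t₀) := by
    simp only [α, Finset.sum_mul_sum]
    exact integrable_finsetSum _ fun i _ => integrable_finsetSum _ fun j _ =>
      integrableOn_mul_of_sq H.closed H.mem (hac i) (hac j) (hY2 i) (hY2 j)
  have hβα : IntegrableOn (fun s => β (flr X t₀ s) * α (flr X t₀ s)) (Ici t₀) := by
    simp only [α, β, Finset.sum_mul_sum]
    exact integrable_finsetSum _ fun i _ => integrable_finsetSum _ fun j _ =>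
      integrableOn_mul_of_sq H.closed H.mem (hbc i) (hac j) (hZ2 i) (hY2 j)
  let d : ℝ → Fin n ⊕ Fin n → ℂ := fun t j => bracket X (Z j) y t
  have hdc : ContinuousOn d (halfLine X t₀) := continuousOn_pi.2 fun j =>
    continuousOn_of_hasDeltaDerivAt H.unbdd H.sturm fun t ht =>
      ⟨_, H.hasDeltaDerivAt_lagrange hy (hZ j) ht⟩
  -- The assumed limit is that of `W^* W` with `W = A^{1/2} N A^{1/2}`.
  have hW : Tendsto (fun t =>
      (CFC.sqrt (weight A₁ A₂ t) * matN X B₂ t * CFC.sqrt (weight A₁ A₂ t))ᴴ *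
      (CFC.sqrt (weight A₁ A₂ t) * matN X B₂ t * CFC.sqrt (weight A₁ A₂ t)))
      (atTop ⊓ 𝓟 (halfLine X t₀)) (𝓝 0) := by
    refine hlim.congr' ?_
    filter_upwards [mem_inf_of_right (mem_principal_self _)] with t ht
    nth_rewrite 2 [← sqrt_mul_sqrt (H.posSemidef t ht)]
    simp only [conjTranspose_mul, conjTranspose_sqrt, mul_assoc]
  obtain ⟨T, hT⟩ := eventually_atTop.1
    (eventually_inf_principal.1 (eventually_norm_mulVec_le hW))
  have hyb : ∀ t ∈ halfLine X t₀, T ≤ t →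
      wnorm (weight A₁ A₂ t) (y t) ≤ (1 + ‖l - l'‖) * (α t * ‖d t‖) := by
    intro t ht hTt
    rw [H.eq_mulVec_sum hy hY ht (hexp y t ht)]
    refine (wnorm_one_add_le (H.posSemidef t ht) (hT t hTt ht) _ _).trans ?_
    gcongr
    refine (wnorm_sum_le _ _ _).trans ?_
    rw [Finset.sum_mul]
    refine Finset.sum_le_sum fun j _ => ?_
    rw [mul_comm]
    refine mul_le_mul_of_nonneg_left ?_ (ha0 j t)
    -- `J` only permutes components and changes signs, so each coefficient is bounded by the sup
    -- norm of `d`.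
    rcases j with i | i
    · rw [Pi.neg_apply, matJ_mulVec_inl, neg_neg]
      exact norm_le_pi_norm (d t) (Sum.inr i)
    · rw [Pi.neg_apply, matJ_mulVec_inr, norm_neg]
      exact norm_le_pi_norm (d t) (Sum.inl i)
  -- The kernel arises from `|(l - l') (Z j)^* A y| ≤ |l - l'| β ‖A^{1/2} y‖` combined with `hyb`.
  obtain ⟨C, hC⟩ : ∃ C, ∀ t ∈ halfLine X t₀, ‖d t‖ ≤ C := by
    refine exists_norm_le_of_integral_ineq (T := T)
      (γ := fun t => ‖l - l'‖ * (1 + ‖l - l'‖) * (β t * α t)) H.closed H.unbdd H.mem hdc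
      (continuousOn_const.mul (hβc.mul hαc))
      (fun t => mul_nonneg (by positivity) (mul_nonneg (hβ0 t) (hα0 t))) (hβα.const_mul _) ?_
    intro p hp q hq hTp hpq
    have hγc : ContinuousOn (fun t => ‖l - l'‖ * (1 + ‖l - l'‖) * (β t * α t) * ‖d t‖)
        (halfLine X t₀) := (continuousOn_const.mul (hβc.mul hαc)).mul hdc.norm
    have hint0 : 0 ≤ ∫ s in p..q, ‖l - l'‖ * (1 + ‖l - l'‖) *
        (β (flr X t₀ s) * α (flr X t₀ s)) * ‖d (flr X t₀ s)‖ :=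
      intervalIntegral.integral_nonneg hpq fun s _ => mul_nonneg
        (mul_nonneg (by positivity) (mul_nonneg (hβ0 _) (hα0 _))) (norm_nonneg _)
    rw [pi_norm_le_iff_of_nonneg (add_nonneg (norm_nonneg _) hint0)]
    intro j
    have hg : ContinuousOn
        (fun t => (l - l') * (star (Z j t) ⬝ᵥ (weight A₁ A₂ t).mulVec (y t))) (halfLine X t₀) :=
      continuousOn_const.mul (H.continuousOn_quadratic (hZc j) hyc)
    have h1 : d q j = d p j + _ := eq_add_integral_of_hasDeltaDerivAt H.closed H.unbdd H.sturm
      H.mem hg (fun t ht => H.hasDeltaDerivAt_lagrange hy (hZ j) ht) hp hq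
    rw [h1]
    refine (norm_add_le _ _).trans (add_le_add (norm_le_pi_norm (d p) j) ?_)
    refine intervalIntegral.norm_integral_le_of_norm_le hpq (.of_forall fun s hs => ?_)
      (intervalIntegrable_comp_flr H.closed H.mem hγc hp.2 hq.2)
    have hf := flr_mem H.closed H.mem s
    have hTf : T ≤ flr X t₀ s := hTp.trans (le_flr hp hs.1.le)
    rw [norm_mul]
    have h2 := norm_star_dotProduct_mulVec_le (H.posSemidef _ hf) (Z j (flr X t₀ s))
      (y (flr X t₀ s))
    have h3 : b j (flr X t₀ s) ≤ β (flr X t₀ s) :=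
      Finset.single_le_sum (fun i _ => hb0 i _) (Finset.mem_univ j)
    calc _ ≤ ‖l - l'‖ * (β (flr X t₀ s) *
          ((1 + ‖l - l'‖) * (α (flr X t₀ s) * ‖d (flr X t₀ s)‖))) := by
          gcongr
          exact h2.trans (mul_le_mul h3 (hyb _ hf hTf) (wnorm_nonneg _ _) (hβ0 _))
      _ = _ := by ring
  rw [H.isSquareIntegrable_iff hyc]
  obtain ⟨t₁, ht₁, hT₁⟩ := exists_mem_gt H.unbdd (max T t₀)
  obtain ⟨hT₁, h01⟩ := max_lt_iff.1 (mem_Ioi.1 hT₁)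
  have hqc : ContinuousOn (fun t => wnorm (weight A₁ A₂ t) (y t) ^ 2) (halfLine X t₀) :=
    (H.continuousOn_wnorm hyc).pow 2
  -- Up to `t₁` continuity suffices; beyond it `hyb` and the bound on `d` dominate the integrand by
  -- a multiple of `α²`.
  rw [← Icc_union_Ici_eq_Ici h01.le]
  refine (integrableOn_comp_flr H.closed H.mem hqc t₁).union ?_
  refine ((hαα.mono_set (Ici_subset_Ici.2 h01.le)).const_mul
    (((1 + ‖l - l'‖) * C) ^ 2)).mono'
    (stronglyMeasurable_comp_flr H.closed H.mem hqc).aestronglyMeasurable ?_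
  refine (ae_restrict_iff' measurableSet_Ici).2 (.of_forall fun s hs => ?_)
  have hf := flr_mem H.closed H.mem s
  have h1 := hyb _ hf (hT₁.le.trans (le_flr ⟨ht₁, h01.le⟩ hs))
  have h2 : wnorm (weight A₁ A₂ (flr X t₀ s)) (y (flr X t₀ s)) ≤
      (1 + ‖l - l'‖) * C * α (flr X t₀ s) := by
    refine h1.trans ?_
    rw [mul_assoc, mul_comm C]
    gcongr
    · exact hα0 _
    · exact hC _ hf
  rw [Real.norm_of_nonneg (sq_nonneg _)]
  refine (pow_le_pow_left₀ (wnorm_nonneg _ _) h2 2).trans (le_of_eq ?_)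
  ring

end IsSystem

end SturmianHamiltonian

theorem mainTheorem9
    (n : ℕ)
    -- the Sturmian time scale
    (X : Set ℝ) (hX_closed : IsClosed X) (hX_unbdd : ¬ BddAbove X)
    (t₀ : ℝ) (ht₀ : t₀ ∈ X) (hX_sturm : SturmianHamiltonian.IsSturmian X t₀)
    -- the coefficients, in block form
    (A₁ A₂ B₁ B₂ B₃ B₄ : ℝ → Matrix (Fin n) (Fin n) ℂ)
    (hA₁ : SturmianHamiltonian.IsRdContinuous X t₀ A₁)
    (hA₂ : SturmianHamiltonian.IsRdContinuous X t₀ A₂)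
    (hB₁ : SturmianHamiltonian.IsRdContinuous X t₀ B₁)
    (hB₂ : SturmianHamiltonian.IsRdContinuous X t₀ B₂)
    (hB₃ : SturmianHamiltonian.IsRdContinuous X t₀ B₃)
    (hB₄ : SturmianHamiltonian.IsRdContinuous X t₀ B₄)
    (A B : ℝ → SturmianHamiltonian.BlockMatrix n)
    (hA : ∀ t, A t = Matrix.fromBlocks (A₁ t) 0 0 (A₂ t))
    (hB : ∀ t, B t = Matrix.fromBlocks (B₁ t) (B₂ t) (B₃ t) (B₄ t))
    (hA_nonneg : ∀ t ∈ SturmianHamiltonian.halfLine X t₀, (A t).PosSemidef)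
    (hE₂ : ∀ t ∈ SturmianHamiltonian.halfLine X t₀,
      IsUnit (1 + (SturmianHamiltonian.mu X t : ℂ) • B₂ t))
    (hE₃ : ∀ t ∈ SturmianHamiltonian.halfLine X t₀,
      IsUnit (1 + (SturmianHamiltonian.mu X t : ℂ) • B₃ t))
    -- all solutions of the system and of its adjoint are square integrable for one parameter
    (l' : ℂ)
    (hsol : ∀ y : ℝ → SturmianHamiltonian.BlockVector n,
      SturmianHamiltonian.IsSolution X t₀ A B l' y →
        SturmianHamiltonian.IsSquareIntegrable X t₀ A y)
    (hadj : ∀ z : ℝ → SturmianHamiltonian.BlockVector n,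
      SturmianHamiltonian.IsAdjointSolution X t₀ A B l' z →
        SturmianHamiltonian.IsSquareIntegrable X t₀ A z)
    -- `A^{1/2} N^* A N A^{1/2} → 0` as `t → ∞` in `X`
    (hlim : Filter.Tendsto
      (fun t => CFC.sqrt (A t) * (SturmianHamiltonian.matN X B₂ t).conjTranspose * A t *
        SturmianHamiltonian.matN X B₂ t * CFC.sqrt (A t))
      (Filter.atTop ⊓ Filter.principal (SturmianHamiltonian.halfLine X t₀)) (nhds 0)) :
    ∀ (l : ℂ) (y : ℝ → SturmianHamiltonian.BlockVector n),
      SturmianHamiltonian.IsSolution X t₀ A B l y →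
        SturmianHamiltonian.IsSquareIntegrable X t₀ A y := by
  obtain rfl : A = SturmianHamiltonian.weight A₁ A₂ := funext hA
  obtain rfl : B = SturmianHamiltonian.potential B₁ B₂ B₃ B₄ := funext hB
  have H : SturmianHamiltonian.IsSystem X t₀ A₁ A₂ B₁ B₂ B₃ B₄ :=
    { closed := hX_closed
      unbdd := hX_unbdd
      mem := ht₀
      sturm := hX_sturm
      contA₁ := hA₁.continuousOn hX_unbdd hX_sturm
      contA₂ := hA₂.continuousOn hX_unbdd hX_sturm
      contB₁ := hB₁.continuousOn hX_unbdd hX_sturm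
      contB₂ := hB₂.continuousOn hX_unbdd hX_sturm
      contB₃ := hB₃.continuousOn hX_unbdd hX_sturm
      contB₄ := hB₄.continuousOn hX_unbdd hX_sturm
      posSemidef := hA_nonneg
      isUnit₂ := hE₂
      isUnit₃ := hE₃ }
  exact fun l y hy => H.isSquareIntegrable_of_isSolution hsol hadj hlim hy
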